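/- Let $\mathbb K\in\{\mathbb R,\mathbb C\}$, let $\Omega\subset\mathbb R^d$ be a bounded open set, let $p\in[2,\infty)$, and let all spaces $L_q(\Omega)$ (with respect to Lebesgue measure) and $C(\overline\Omega)$ consist of $\mathbb K$-valued functions. For $u\in L_2(\Omega)$ we say that $u\in C(\overline\Omega)$ if $u$ coincides almost everywhere on $\Omega$ with a (necessarily unique) continuous function on $\overline\Omega$; we then identify $u$ with that function, so that $u(x)$ is defined for every $x\in\overline\Omega$. Let $S=(S_t)_{t>0}$ be a semigroup of bounded linear operators on $L_2(\Omega)$, that is, $S_{t+s}=S_tS_s$ for all $s,t>0$. Suppose that 1. $S_tL_p(\Omega)\subset C(\overline\Omega)$ and $S_t^*L_p(\Omega)\subset C(\overline\Omega)$ for all $t>0$; 2. for all $x\in\overline\Omega$ there are $t>0$ and $w\in L_p(\Omega)$ such that $(S_tw)(x)\neq0$; 3. for all $x\in\overline\Omega$ there are $t>0$ and $w\in L_p(\Omega)$ such that $(S_t^*w)(x)\neq0$. Suppose further that the restrictions $T_t=S_t|_{L_p(\Omega)}$, $t>0$, form a positive irreducible holomorphic $C_0$-semigroup of bounded operators on $L_p(\Omega)$.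 Here: - *$C_0$-semigroup* means that $T$ is a semigroup and $\lim_{t\downarrow0}T_tu=u$ in $L_p(\Omega)$ for all $u\in L_p(\Omega)$; - *positive* means that $u\ge0$ a.e. implies $T_tu\ge0$ a.e. for all $t>0$; - *irreducible* means that the only closed ideals $J$ of $L_p(\Omega)$ with $T_tJ\subset J$ for all $t>0$ are $\{0\}$ and $L_p(\Omega)$, where an ideal is a linear subspace $J$ such that $u\in J$ implies $|u|\in J$, and such that $u\in J$ and $0\le v\le u$ imply $v\in J$; - *holomorphic* means that $T$ (its complexification on $L_p(\Omega;\mathbb C)$ if $\mathbb K=\mathbb R$) extends, for some $\theta\in(0,\pi/2]$, to a holomorphic operator-valued map $Z$ on the sector $\Sigma_\theta=\{z\in\mathbb C\setminus\{0\}:|\arg z|<\theta\}$ such that $Z(z+w)=Z(z)Z(w)$ for all $z,w\in\Sigma_\theta$ and $Z(z)u\to u$ as $z\to0$ in $\Sigma_{\theta'}$, for all $\theta'\in(0,\theta)$ and all $u$. Then for every $t>0$ one has $S_tL_2(\Omega)\subset C(\overline\Omega)$ and there exists a function $K_t\in C(\overline\Omega\times\overline\Omega)$ such that $$(S_tu)(x)=\int_\Omega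 K_t(x,y)\,u(y)\,dy\qquad\text{for all }u\in L_2(\Omega)\text{ and }x\in\overline\Omega,$$ and moreover $K_t(x,y)>0$ for all $x,y\in\overline\Omega$ and all $t>0$. -/

import Mathlib

open MeasureTheory Filter Topology Set
open scoped ENNReal ComplexOrder

namespace StrictPos

/-! ### Operator semigroups on Banach spaces

A semigroup is a map from `(0, ∞)` to the bounded operators; it is represented by a function on `ℝ`
of which only the values at positive times are ever used. -/

/-- The semigroup law `S_{t+s} = S_t S_s` for all `s, t > 0`. -/
def IsSemigroup {𝕜 E : Type*} [RCLike 𝕜] [NormedAddCommGroup E] [NormedSpace 𝕜 E]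
    (S : ℝ → E →L[𝕜] E) : Prop :=
  ∀ s t : ℝ, 0 < s → 0 < t → S (t + s) = (S t).comp (S s)

/-- A `C₀`-semigroup: a semigroup with `S_t u → u` as `t ↓ 0`, for all `u`. -/
structure IsC0Semigroup {𝕜 E : Type*} [RCLike 𝕜] [NormedAddCommGroup E] [NormedSpace 𝕜 E]
    (S : ℝ → E →L[𝕜] E) : Prop where
  semigroup : IsSemigroup S
  tendsto_zero : ∀ u : E, Tendsto (fun t => S t u) (𝓝[>] 0) (𝓝 u)

/-- The open sector `{z ∈ ℂ \ {0} : |arg z| < θ}`. -/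
def sector (θ : ℝ) : Set ℂ := {z : ℂ | z ≠ 0 ∧ |z.arg| < θ}

/-- `Z` is a holomorphic `C₀`-semigroup of angle `θ` on the complex Banach space `E`: it is
holomorphic on the sector of angle `θ`, satisfies the semigroup law there, and converges strongly
to the identity at `0` within each smaller sector. -/
structure IsHolomorphicC0SemigroupOfAngle {E : Type*} [NormedAddCommGroup E] [NormedSpace ℂ E]
    (θ : ℝ) (Z : ℂ → E →L[ℂ] E) : Prop where
  differentiableOn : DifferentiableOn ℂ Z (sector θ)
  semigroup : ∀ z ∈ sector θ, ∀ w ∈ sector θ, Z (z + w) = (Z z).comp (Z w)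
  tendsto_zero : ∀ θ' : ℝ, 0 < θ' → θ' < θ → ∀ u : E,
    Tendsto (fun z => Z z u) (𝓝[sector θ'] 0) (𝓝 u)

/-! ### Function spaces over an open subset of Euclidean space -/

/-- The space `L_p(Ω)` of `𝕜`-valued functions with respect to Lebesgue measure on `Ω`. -/
noncomputable abbrev LpOn (𝕜 : Type*) [RCLike 𝕜] (p : ℝ≥0∞) {d : ℕ} (Ω : Set (EuclideanSpace ℝ (Fin d))) :=
  Lp 𝕜 p (volume.restrict Ω)

/-- A `C₀`-semigroup on `L_p(Ω)` over `𝕜` (real or complex) is holomorphic if its complexification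
on the complex space `L_p(Ω; ℂ)` extends to a holomorphic `C₀`-semigroup on a sector.
`RCLike.map 𝕜 ℂ` is the inclusion of `ℝ` into `ℂ` for `𝕜 = ℝ`, and the identity for `𝕜 = ℂ`, in
which case this is just holomorphy of the semigroup itself. -/
def IsHolomorphic {𝕜 : Type*} [RCLike 𝕜] {p : ℝ≥0∞} [Fact (1 ≤ p)] {d : ℕ}
    {Ω : Set (EuclideanSpace ℝ (Fin d))} (T : ℝ → LpOn 𝕜 p Ω →L[𝕜] LpOn 𝕜 p Ω) : Prop :=
  ∃ θ : ℝ, 0 < θ ∧ θ ≤ Real.pi / 2 ∧ ∃ Z : ℂ → LpOn ℂ p Ω →L[ℂ] LpOn ℂ p Ω,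
    IsHolomorphicC0SemigroupOfAngle θ Z ∧
    ∀ t : ℝ, 0 < t → ∀ u : LpOn 𝕜 p Ω,
      Z (t : ℂ) ((RCLike.map 𝕜 ℂ).compLp u) = (RCLike.map 𝕜 ℂ).compLp (T t u)

/-- Positivity: each `T_t`, `t > 0`, maps functions with values in `[0, ∞)` a.e. to such functions.
(In `𝕜`, `0 ≤ z` means that `z` is real and nonnegative.) -/
def IsPositive {𝕜 : Type*} [RCLike 𝕜] {p : ℝ≥0∞} [Fact (1 ≤ p)] {d : ℕ}
    {Ω : Set (EuclideanSpace ℝ (Fin d))} (T : ℝ → LpOn 𝕜 p Ω →L[𝕜] LpOn 𝕜 p Ω) : Prop :=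
  ∀ t : ℝ, 0 < t → ∀ u : LpOn 𝕜 p Ω,
    (∀ᵐ x ∂volume.restrict Ω, 0 ≤ u x) → ∀ᵐ x ∂volume.restrict Ω, 0 ≤ T t u x

/-- An ideal of the Banach lattice `L_p(Ω)`: a subspace which contains `|u|` for each of its
elements `u`, and contains `v` whenever `0 ≤ v ≤ u` for one of its elements `u`. -/
structure IsLatticeIdeal {𝕜 : Type*} [RCLike 𝕜] {p : ℝ≥0∞} {d : ℕ}
    {Ω : Set (EuclideanSpace ℝ (Fin d))} (J : Submodule 𝕜 (LpOn 𝕜 p Ω)) : Prop where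
  abs_mem : ∀ u ∈ J, ∀ v : LpOn 𝕜 p Ω,
    (∀ᵐ x ∂volume.restrict Ω, v x = ((‖u x‖ : ℝ) : 𝕜)) → v ∈ J
  mem_of_le : ∀ u ∈ J, ∀ v : LpOn 𝕜 p Ω,
    (∀ᵐ x ∂volume.restrict Ω, 0 ≤ v x ∧ v x ≤ u x) → v ∈ J

/-- Irreducibility: the only closed ideals left invariant by all `T_t`, `t > 0`, are the trivial
ones. -/
def IsIrreducible {𝕜 : Type*} [RCLike 𝕜] {p : ℝ≥0∞} [Fact (1 ≤ p)] {d : ℕ}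
    {Ω : Set (EuclideanSpace ℝ (Fin d))} (T : ℝ → LpOn 𝕜 p Ω →L[𝕜] LpOn 𝕜 p Ω) : Prop :=
  ∀ J : Submodule 𝕜 (LpOn 𝕜 p Ω), IsLatticeIdeal J → IsClosed (J : Set (LpOn 𝕜 p Ω)) →
    (∀ t : ℝ, 0 < t → ∀ u ∈ J, T t u ∈ J) → J = ⊤ ∨ J = ⊥

/-- `T` is the restriction to `L_p(Ω)` of the operators `S_t` on `L_2(Ω)`: whenever `u ∈ L_p(Ω)`
and `v ∈ L_2(Ω)` are the same function a.e., so are `T_t u` and `S_t v`. -/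
def IsRestriction {𝕜 : Type*} [RCLike 𝕜] {p : ℝ≥0∞} [Fact (1 ≤ p)] {d : ℕ}
    {Ω : Set (EuclideanSpace ℝ (Fin d))} (T : ℝ → LpOn 𝕜 p Ω →L[𝕜] LpOn 𝕜 p Ω)
    (S : ℝ → LpOn 𝕜 2 Ω →L[𝕜] LpOn 𝕜 2 Ω) : Prop :=
  ∀ t : ℝ, 0 < t → ∀ (u : LpOn 𝕜 p Ω) (v : LpOn 𝕜 2 Ω),
    u =ᵐ[volume.restrict Ω] v → T t u =ᵐ[volume.restrict Ω] S t v

/-- `g` restricted to `Ω̄` is the (necessarily unique) element of `C(Ω̄)` which coincides with `u`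
almost everywhere on `Ω`. The values of `g` outside `Ω̄` are irrelevant. -/
def IsContVersion {𝕜 : Type*} [RCLike 𝕜] {d : ℕ} (Ω : Set (EuclideanSpace ℝ (Fin d)))
    (u g : EuclideanSpace ℝ (Fin d) → 𝕜) : Prop :=
  ContinuousOn g (closure Ω) ∧ g =ᵐ[volume.restrict Ω] u

/-- `R L_p(Ω) ⊂ C(Ω̄)`, for an operator `R` on `L_2(Ω)` (and `L_p(Ω) ⊂ L_2(Ω)`). -/
def MapsLpIntoC {𝕜 : Type*} [RCLike 𝕜] (p : ℝ≥0∞) {d : ℕ}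
    {Ω : Set (EuclideanSpace ℝ (Fin d))} (R : LpOn 𝕜 2 Ω →L[𝕜] LpOn 𝕜 2 Ω) : Prop :=
  ∀ u : LpOn 𝕜 2 Ω, MemLp u p (volume.restrict Ω) → ∃ g, IsContVersion Ω (R u) g

/-- There are `t > 0` and `w ∈ L_p(Ω)` such that `(S_t w)(x) ≠ 0`, where `S_t w` is identified with
its continuous version on `Ω̄`. -/
def NonvanishingAt {𝕜 : Type*} [RCLike 𝕜] (p : ℝ≥0∞) {d : ℕ}
    {Ω : Set (EuclideanSpace ℝ (Fin d))} (S : ℝ → LpOn 𝕜 2 Ω →L[𝕜] LpOn 𝕜 2 Ω)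
    (x : EuclideanSpace ℝ (Fin d)) : Prop :=
  ∃ t : ℝ, 0 < t ∧ ∃ w : LpOn 𝕜 2 Ω, MemLp w p (volume.restrict Ω) ∧
    ∃ g, IsContVersion Ω (S t w) g ∧ g x ≠ 0

end StrictPos

/-! Regularity. `S` inherits positivity from `T`. For positive `A`, Jensen gives `(Af)^r ≤ M^(r-1)
A(f^r)` when `A1 ≤ M`. Pairing with `(Af)^(r/p) ∈ L_p`, which the adjoint sends to a bounded
function, gains the exponent `r + r/p` for `Af` (`IsPos.memLp_improve`). Finitely many halvings of
time lead from `L_2` to `L_p`, hence into `C(Ω̄)`. By closed graph and Riesz, evaluation at `x`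
after `S_t` is the pairing with some `k_t(x) ∈ L_2`, and likewise `k'_t(y)` for the adjoint. The
kernel is `K_t(x,y) = ⟨k_{t/2}(x), k'_{t/2}(y)⟩`.

Strict positivity. Read `K_t(x,y)` as `(S_{t/2} f)(x)` with `f = k'_{t/2}(y) ≥ 0`. Suppose `(S_{t₀}
f)(x) = 0`. Cut `f` down to `f_m ≤ 2 T_{a_n} f` for `n ≥ m`, with `a_n → 0`. Then `(S_{t₀-a_n}
f_m)(x) = 0`, so the analytic function `t ↦ (S_t f_m)(x)` has accumulating zeros and vanishes; let
`m → ∞`. Thus `f` is annihilated by all `k_r(x)`. The functions so annihilated form a closed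
invariant ideal, so irreducibility and `hSx` force `f = 0`. But `k'_t(y) = 0` would persist to later
times by the semigroup law and to earlier ones by analyticity, against `hSx'`. -/

namespace StrictPos

/-! ### Positivity and absolute values in `L_q` -/

section Lattice

variable {α : Type*} [MeasurableSpace α] {μ : Measure α} {𝕜 : Type*} [RCLike 𝕜] {q : ℝ≥0∞}

/-- Being nonnegative a.e. -/
def IsNonneg (u : Lp 𝕜 q μ) : Prop := ∀ᵐ x ∂μ, 0 ≤ u x

theorem eq_ofReal_norm_of_nonneg {z : 𝕜} (hz : 0 ≤ z) : z = ((‖z‖ : ℝ) : 𝕜) := by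
  rw [RCLike.nonneg_iff] at hz
  have h : z = ((RCLike.re z : ℝ) : 𝕜) := by
    apply RCLike.ext <;> simp [hz.2]
  rw [h, RCLike.norm_ofReal, abs_of_nonneg hz.1]

/-- The element of `L_q` given by a real-valued function. -/
noncomputable def realLp (f : α → ℝ) (hf : MemLp f q μ) : Lp 𝕜 q μ :=
  (MemLp.ofReal (K := 𝕜) hf).toLp _

theorem coeFn_realLp (f : α → ℝ) (hf : MemLp f q μ) :
    (realLp f hf : Lp 𝕜 q μ) =ᵐ[μ] fun x => ((f x : ℝ) : 𝕜) :=
  MemLp.coeFn_toLp _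

/-- The absolute value in `L_q`. -/
noncomputable def absLp (u : Lp 𝕜 q μ) : Lp 𝕜 q μ := realLp (fun x => ‖u x‖) (Lp.memLp u).norm

theorem coeFn_absLp (u : Lp 𝕜 q μ) : absLp u =ᵐ[μ] fun x => ((‖u x‖ : ℝ) : 𝕜) :=
  coeFn_realLp _ _

theorem isNonneg_realLp {f : α → ℝ} {hf : MemLp f q μ} (h : ∀ᵐ x ∂μ, 0 ≤ f x) :
    IsNonneg (realLp f hf : Lp 𝕜 q μ) := by
  filter_upwards [coeFn_realLp (𝕜 := 𝕜) f hf, h] with x hx h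
  rw [hx]; exact RCLike.ofReal_nonneg.2 h

theorem isNonneg_absLp (u : Lp 𝕜 q μ) : IsNonneg (absLp u) :=
  isNonneg_realLp (ae_of_all _ fun _ => norm_nonneg _)

/-- The product of an element of `L_q` with the indicator function of a measurable set. -/
noncomputable def cutLp (s : Set α) (hs : MeasurableSet s) (u : Lp 𝕜 q μ) : Lp 𝕜 q μ :=
  ((Lp.memLp u).indicator hs).toLp _

theorem coeFn_cutLp (s : Set α) (hs : MeasurableSet s) (u : Lp 𝕜 q μ) :
    cutLp s hs u =ᵐ[μ] s.indicator u :=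
  MemLp.coeFn_toLp _

theorem IsNonneg.cutLp {u : Lp 𝕜 q μ} (hu : IsNonneg u) (s : Set α) (hs : MeasurableSet s) :
    IsNonneg (cutLp s hs u) := by
  filter_upwards [hu, coeFn_cutLp s hs u] with x hx h
  rw [h]; by_cases hxs : x ∈ s <;> simp [hxs, hx]

theorem exists_subseq_tendsto_ae [Fact (1 ≤ q)] {u : ℕ → Lp 𝕜 q μ} {v : Lp 𝕜 q μ}
    (h : Tendsto u atTop (𝓝 v)) : ∃ φ : ℕ → ℕ, StrictMono φ ∧
      ∀ᵐ x ∂μ, Tendsto (fun n => u (φ n) x) atTop (𝓝 (v x)) :=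
  (tendstoInMeasure_of_tendsto_Lp h).exists_seq_tendsto_ae

theorem IsNonneg.of_tendsto [Fact (1 ≤ q)] {u : ℕ → Lp 𝕜 q μ} {v : Lp 𝕜 q μ}
    (h : Tendsto u atTop (𝓝 v)) (hu : ∀ n, IsNonneg (u n)) : IsNonneg v := by
  obtain ⟨φ, -, hφ⟩ := exists_subseq_tendsto_ae h
  filter_upwards [hφ, ae_all_iff.2 hu] with x hx hu
  exact ge_of_tendsto' hx fun n => hu _

local notation "⟪" x ", " y "⟫" => inner 𝕜 x y

theorem inner_of_isNonneg {u v : Lp 𝕜 2 μ} (hu : IsNonneg u) (hv : IsNonneg v) :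
    ⟪u, v⟫ = ((∫ x, ‖u x‖ * ‖v x‖ ∂μ : ℝ) : 𝕜) := by
  rw [L2.inner_def, ← integral_ofReal]
  refine integral_congr_ae ?_
  filter_upwards [hu, hv] with x hu hv
  rw [eq_ofReal_norm_of_nonneg hu, eq_ofReal_norm_of_nonneg hv]
  simp [mul_comm]

theorem inner_nonneg_of_isNonneg {u v : Lp 𝕜 2 μ} (hu : IsNonneg u) (hv : IsNonneg v) :
    0 ≤ ⟪u, v⟫ := by
  rw [inner_of_isNonneg hu hv, RCLike.ofReal_nonneg]
  exact integral_nonneg fun x => by positivity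

theorem integrable_norm_mul_norm (u v : Lp 𝕜 2 μ) : Integrable (fun x => ‖u x‖ * ‖v x‖) μ :=
  (Lp.memLp u).norm.integrable_mul (Lp.memLp v).norm

/-- Testing against indicators makes every set integral of `u` real and nonnegative. -/
theorem isNonneg_of_inner_nonneg [IsFiniteMeasure μ] {u : Lp 𝕜 2 μ}
    (h : ∀ v : Lp 𝕜 2 μ, IsNonneg v → 0 ≤ ⟪v, u⟫) : IsNonneg u := by
  have hu : Integrable u μ := (Lp.memLp u).integrable (by norm_num)
  have key : ∀ s, MeasurableSet s → 0 ≤ ∫ x in s, u x ∂μ := by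
    intro s hs
    have h1 := h (indicatorConstLp 2 hs (measure_ne_top μ s) (1 : 𝕜)) (by
      filter_upwards [indicatorConstLp_coeFn (p := 2) (hs := hs) (hμs := measure_ne_top μ s)
        (c := (1 : 𝕜))] with x hx
      rw [hx]; by_cases hxs : x ∈ s <;> simp [hxs])
    rwa [L2.inner_indicatorConstLp_one] at h1
  have hre : 0 ≤ᵐ[μ] fun x => RCLike.re (u x) :=
    ae_nonneg_of_forall_setIntegral_nonneg hu.re fun s hs _ => by
      have := (RCLike.nonneg_iff.1 (key s hs)).1
      rwa [← integral_re hu.integrableOn] at this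
  have him : (fun x => RCLike.im (u x)) =ᵐ[μ] 0 :=
    hu.im.ae_eq_zero_of_forall_setIntegral_eq_zero fun s hs _ => by
      have := (RCLike.nonneg_iff.1 (key s hs)).2
      rwa [← integral_im hu.integrableOn] at this
  filter_upwards [hre, him] with x h1 h2
  exact RCLike.nonneg_iff.2 ⟨h1, h2⟩

/-- Positivity of an operator. -/
def IsPos [Fact (1 ≤ q)] (A : Lp 𝕜 q μ →L[𝕜] Lp 𝕜 q μ) : Prop := ∀ u, IsNonneg u → IsNonneg (A u)

theorem IsPos.adjoint [IsFiniteMeasure μ] {A : Lp 𝕜 2 μ →L[𝕜] Lp 𝕜 2 μ} (hA : IsPos A) :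
    IsPos (ContinuousLinearMap.adjoint A) := fun u hu =>
  isNonneg_of_inner_nonneg fun v hv => by
    rw [ContinuousLinearMap.adjoint_inner_right]
    exact inner_nonneg_of_isNonneg (hA v hv) hu

theorem norm_le_of_add_sub_nonneg {a b : 𝕜} (ha : 0 ≤ a) (h1 : 0 ≤ a + b) (h2 : 0 ≤ a - b) :
    ‖b‖ ≤ ‖a‖ := by
  have hb : b = ((RCLike.re b : ℝ) : 𝕜) := by
    rw [RCLike.nonneg_iff] at ha h1
    have := h1.2
    rw [map_add, ha.2, zero_add] at this
    apply RCLike.ext <;> simp [this]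
  have ha' : a = ((RCLike.re a : ℝ) : 𝕜) := by
    rw [RCLike.nonneg_iff] at ha
    apply RCLike.ext <;> simp [ha.2]
  rw [RCLike.nonneg_iff] at ha h1 h2
  simp only [map_add, map_sub] at h1 h2
  rw [hb, ha', RCLike.norm_ofReal, RCLike.norm_ofReal, abs_of_nonneg ha.1, abs_le]
  constructor <;> linarith [h1.1, h2.1]

/-- From `-|u| ≤ v ≤ |u|` one gets `±Av ≤ A|u|`. -/
theorem IsPos.norm_apply_le_of_real [Fact (1 ≤ q)] {A : Lp 𝕜 q μ →L[𝕜] Lp 𝕜 q μ} (hA : IsPos A)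
    {u v : Lp 𝕜 q μ} (hv : ∀ᵐ x ∂μ, ∃ r : ℝ, v x = r ∧ |r| ≤ ‖u x‖) :
    ∀ᵐ x ∂μ, ‖A v x‖ ≤ ‖A (absLp u) x‖ := by
  have h1 : IsNonneg (absLp u + v) := by
    filter_upwards [hv, coeFn_absLp u, Lp.coeFn_add (absLp u) v] with x ⟨r, hr, hr'⟩ h1 h2
    rw [h2, Pi.add_apply, h1, hr, ← RCLike.ofReal_add, RCLike.ofReal_nonneg]
    linarith [(abs_le.1 hr').1]
  have h2 : IsNonneg (absLp u - v) := by
    filter_upwards [hv, coeFn_absLp u, Lp.coeFn_sub (absLp u) v] with x ⟨r, hr, hr'⟩ h1 h2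
    rw [h2, Pi.sub_apply, h1, hr, ← RCLike.ofReal_sub, RCLike.ofReal_nonneg]
    linarith [(abs_le.1 hr').2]
  have h3 := hA _ h1
  have h4 := hA _ h2
  rw [map_add] at h3
  rw [map_sub] at h4
  filter_upwards [hA _ (isNonneg_absLp u), h3, h4, Lp.coeFn_add (A (absLp u)) (A v),
    Lp.coeFn_sub (A (absLp u)) (A v)] with x h5 h6 h7 h8 h9
  rw [h8] at h6
  rw [h9] at h7
  exact norm_le_of_add_sub_nonneg h5 h6 h7

/-- Real and imaginary parts are each dominated by `|u|`, whence the factor 2. The sharp constant 1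
is not needed: only integrability and zero sets are transferred. -/
theorem IsPos.norm_apply_le [Fact (1 ≤ q)] {A : Lp 𝕜 q μ →L[𝕜] Lp 𝕜 q μ} (hA : IsPos A)
    (u : Lp 𝕜 q μ) : ∀ᵐ x ∂μ, ‖A u x‖ ≤ 2 * ‖A (absLp u) x‖ := by
  set a : Lp 𝕜 q μ := realLp (fun x => RCLike.re (u x)) (Lp.memLp u).re with ha
  set b : Lp 𝕜 q μ := realLp (fun x => RCLike.im (u x)) (Lp.memLp u).im with hb
  have ha' := coeFn_realLp (𝕜 := 𝕜) (fun x => RCLike.re (u x)) (Lp.memLp u).re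
  have hb' := coeFn_realLp (𝕜 := 𝕜) (fun x => RCLike.im (u x)) (Lp.memLp u).im
  have h1 : ∀ᵐ x ∂μ, ‖A a x‖ ≤ ‖A (absLp u) x‖ := hA.norm_apply_le_of_real (by
    filter_upwards [ha'] with x hx
    exact ⟨_, hx, RCLike.abs_re_le_norm _⟩)
  have h2 : ∀ᵐ x ∂μ, ‖A b x‖ ≤ ‖A (absLp u) x‖ := hA.norm_apply_le_of_real (by
    filter_upwards [hb'] with x hx
    exact ⟨_, hx, RCLike.abs_im_le_norm _⟩)
  have h3 : u = a + (RCLike.I : 𝕜) • b := by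
    apply Lp.ext
    filter_upwards [ha', hb', Lp.coeFn_add a ((RCLike.I : 𝕜) • b),
      Lp.coeFn_smul (RCLike.I : 𝕜) b] with x h1 h2 h3 h4
    rw [h3, Pi.add_apply, h4, Pi.smul_apply, h1, h2, smul_eq_mul, mul_comm, RCLike.re_add_im]
  have h4 : A u = A a + (RCLike.I : 𝕜) • A b := by
    conv_lhs => rw [h3, map_add, map_smul]
  filter_upwards [h1, h2, Lp.coeFn_add (A a) ((RCLike.I : 𝕜) • A b),
    Lp.coeFn_smul (RCLike.I : 𝕜) (A b)] with x h1 h2 h5 h6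
  rw [h4, h5, Pi.add_apply, h6, Pi.smul_apply]
  have h7 : ‖(RCLike.I : 𝕜) • A b x‖ ≤ ‖A b x‖ := by
    rw [norm_smul]
    refine mul_le_of_le_one_left (norm_nonneg _) ?_
    rcases eq_or_ne (RCLike.I : 𝕜) 0 with h | h
    · simp [h]
    · exact (RCLike.norm_I_of_ne_zero h).le
  linarith [norm_add_le (A a x) ((RCLike.I : 𝕜) • A b x)]

/-- Dominated convergence with majorant `|f|^2`. The sets need only exhaust the support of `f`. -/
theorem tendsto_cutLp (f : Lp 𝕜 2 μ) (s : ℕ → Set α) (hs : ∀ n, MeasurableSet (s n))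
    (h : ∀ᵐ x ∂μ, ∀ᶠ n in atTop, f x = 0 ∨ x ∈ s n) :
    Tendsto (fun n => cutLp (s n) (hs n) f) atTop (𝓝 f) := by
  have h1 : Tendsto (fun n => ∫ x, ‖(s n)ᶜ.indicator f x‖ ^ 2 ∂μ) atTop (𝓝 (∫ x, (0 : ℝ) ∂μ)) := by
    refine tendsto_integral_of_dominated_convergence (fun x => ‖f x‖ ^ 2) (fun n => ?_) ?_
      (fun n => ae_of_all _ fun x => ?_) ?_
    · exact (((Lp.aestronglyMeasurable f).indicator (hs n).compl).norm.pow 2)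
    · exact (Lp.memLp f).norm.integrable_sq
    · rw [Real.norm_of_nonneg (by positivity)]
      gcongr
      exact norm_indicator_le_norm_self _ _
    · filter_upwards [h] with x hx
      refine tendsto_const_nhds.congr' ?_
      filter_upwards [hx] with n hn
      rcases hn with hn | hn
      · by_cases hxs : x ∈ (s n)ᶜ
        · rw [indicator_of_mem hxs, hn]; simp
        · rw [indicator_of_notMem hxs]; simp
      · rw [indicator_of_notMem (not_not.2 hn)]; simp
  rw [tendsto_iff_norm_sub_tendsto_zero]
  rw [integral_zero] at h1
  have h2 : ∀ n, ‖cutLp (s n) (hs n) f - f‖ = √(∫ x, ‖(s n)ᶜ.indicator f x‖ ^ 2 ∂μ) := by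
    intro n
    rw [@norm_eq_sqrt_re_inner 𝕜, L2.inner_def, ← integral_re (L2.integrable_inner _ _)]
    congr 1
    refine integral_congr_ae ?_
    filter_upwards [Lp.coeFn_sub (cutLp (s n) (hs n) f) f, coeFn_cutLp (s n) (hs n) f] with x h1 h2
    rw [h1, inner_self_eq_norm_sq, Pi.sub_apply, h2]
    by_cases hx : x ∈ s n <;> simp [hx]
  simp_rw [h2]
  simpa using h1.sqrt

end Lattice
-- Continuous versions on the closure
section ContVersion

variable {𝕜 : Type*} [RCLike 𝕜] {d : ℕ} {Ω : Set (EuclideanSpace ℝ (Fin d))}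

theorem IsContVersion.eqOn {u v g h : EuclideanSpace ℝ (Fin d) → 𝕜} (hΩ : IsOpen Ω)
    (hg : IsContVersion Ω u g) (hh : IsContVersion Ω v h) (huv : u =ᵐ[volume.restrict Ω] v) :
    EqOn g h (closure Ω) := by
  have h1 : EqOn g h Ω := Measure.eqOn_open_of_ae_eq (hg.2.trans (huv.trans hh.2.symm)) hΩ
    (hg.1.mono subset_closure) (hh.1.mono subset_closure)
  exact h1.of_subset_closure hg.1 hh.1 subset_closure subset_rfl

/-- `|g|` is also a continuous version of `u`, so it equals `g` by uniqueness. -/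
theorem IsContVersion.nonneg {u g : EuclideanSpace ℝ (Fin d) → 𝕜} (hΩ : IsOpen Ω)
    (hg : IsContVersion Ω u g) (hu : ∀ᵐ x ∂volume.restrict Ω, 0 ≤ u x) :
    ∀ x ∈ closure Ω, 0 ≤ g x := by
  have h : IsContVersion Ω u (fun x => ((‖g x‖ : ℝ) : 𝕜)) := by
    refine ⟨RCLike.continuous_ofReal.comp_continuousOn hg.1.norm, ?_⟩
    filter_upwards [hg.2, hu] with x h1 h2
    rw [h1, ← eq_ofReal_norm_of_nonneg h2]
  intro x hx
  rw [hg.eqOn hΩ h EventuallyEq.rfl hx]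
  exact RCLike.ofReal_nonneg.2 (norm_nonneg _)

theorem IsContVersion.exists_bound {u g : EuclideanSpace ℝ (Fin d) → 𝕜}
    (hΩb : Bornology.IsBounded Ω) (hΩ : IsOpen Ω) (hg : IsContVersion Ω u g) :
    ∃ M : ℝ, 0 < M ∧ ∀ᵐ x ∂volume.restrict Ω, ‖u x‖ ≤ M := by
  obtain ⟨C, hC⟩ := hΩb.isCompact_closure.exists_bound_of_continuousOn hg.1
  refine ⟨max C 1, by positivity, ?_⟩
  filter_upwards [hg.2, ae_restrict_mem hΩ.measurableSet] with x hx hxΩ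
  rw [← hx]
  exact (hC x (subset_closure hxΩ)).trans (le_max_left _ _)

theorem isFiniteMeasure_restrict_of_isBounded (hΩb : Bornology.IsBounded Ω) :
    IsFiniteMeasure ((volume : Measure (EuclideanSpace ℝ (Fin d))).restrict Ω) :=
  MeasureTheory.isFiniteMeasure_restrict.2 hΩb.measure_lt_top.ne

end ContVersion

/-! ### Jensen's inequality and gain of integrability -/

section Improvement

variable {α : Type*} [MeasurableSpace α] {μ : Measure α} {𝕜 : Type*} [RCLike 𝕜]

local notation "⟪" x ", " y "⟫" => inner 𝕜 x y

/-- The convex function `a ↦ a^r` lies above its tangent at `l`. Being affine in `a`, the tangent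
can be pushed through a positive operator. -/
theorem young_tangent {a l r : ℝ} (ha : 0 ≤ a) (hl : 0 ≤ l) (hr : 1 < r) :
    r * l ^ (r - 1) * a ≤ a ^ r + (r - 1) * l ^ r := by
  have hr0 : r ≠ 0 := by linarith
  have hr1 : r - 1 ≠ 0 := by linarith
  have h := Real.young_inequality_of_nonneg ha (Real.rpow_nonneg hl (r - 1))
    (Real.HolderConjugate.conjExponent hr)
  rw [← Real.rpow_mul hl, Real.conjExponent, mul_div_cancel₀ _ hr1] at h
  have h2 : a ^ r / r + l ^ r / (r / (r - 1)) = (a ^ r + (r - 1) * l ^ r) / r := by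
    field_simp
  rw [h2, le_div_iff₀ (by linarith)] at h
  linarith

/-- Jensen's inequality for a positive operator. -/
theorem IsPos.rpow_apply_le [IsFiniteMeasure μ] {A : Lp 𝕜 2 μ →L[𝕜] Lp 𝕜 2 μ} (hA : IsPos A)
    {M : ℝ} (hM : 0 < M)
    (hA1 : ∀ᵐ x ∂μ, ‖A (realLp (fun _ => 1) (memLp_const 1)) x‖ ≤ M) {r : ℝ} (hr : 1 < r)
    {f : α → ℝ} (hf0 : ∀ x, 0 ≤ f x) (hf : MemLp f 2 μ) (hfr : MemLp (fun x => f x ^ r) 2 μ) :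
    ∀ᵐ x ∂μ, ‖A (realLp f hf) x‖ ^ r ≤ M ^ (r - 1) * ‖A (realLp _ hfr) x‖ := by
  set one : Lp 𝕜 2 μ := realLp (fun _ => 1) (memLp_const 1) with hone
  set F : Lp 𝕜 2 μ := realLp f hf with hF
  set G : Lp 𝕜 2 μ := realLp _ hfr with hG
  have hF0 : IsNonneg (A F) := hA _ (isNonneg_realLp (ae_of_all _ hf0))
  have hG0 : IsNonneg (A G) :=
    hA _ (isNonneg_realLp (ae_of_all _ fun x => Real.rpow_nonneg (hf0 x) r))
  have h10 : IsNonneg (A one) := hA _ (isNonneg_realLp (ae_of_all _ fun x => zero_le_one))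
  -- Each tangent point has its own null set. Rational points keep the union null, and continuity
  -- then yields all real ones.
  have key : ∀ c : ℚ, ∀ᵐ x ∂μ, r * |(c : ℝ)| ^ (r - 1) * ‖A F x‖ ≤
      ‖A G x‖ + (r - 1) * |(c : ℝ)| ^ r * ‖A one x‖ := by
    intro c
    set l : ℝ := |(c : ℝ)|
    have hl : 0 ≤ l := abs_nonneg _
    have h1 : IsNonneg (G + (((r - 1) * l ^ r : ℝ) : 𝕜) • one -
        ((r * l ^ (r - 1) : ℝ) : 𝕜) • F) := by
      filter_upwards [coeFn_realLp (𝕜 := 𝕜) _ hf, coeFn_realLp (𝕜 := 𝕜) _ hfr,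
        coeFn_realLp (𝕜 := 𝕜) (fun _ : α => (1 : ℝ)) (memLp_const (μ := μ) (p := 2) 1),
        Lp.coeFn_sub (G + (((r - 1) * l ^ r : ℝ) : 𝕜) • one) (((r * l ^ (r - 1) : ℝ) : 𝕜) • F),
        Lp.coeFn_add G ((((r - 1) * l ^ r : ℝ) : 𝕜) • one),
        Lp.coeFn_smul (((r - 1) * l ^ r : ℝ) : 𝕜) one,
        Lp.coeFn_smul ((r * l ^ (r - 1) : ℝ) : 𝕜) F] with x e1 e2 e3 e4 e5 e6 e7
      rw [e4, Pi.sub_apply, e5, Pi.add_apply, e6, e7, Pi.smul_apply, Pi.smul_apply, hF, e1, hG, e2,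
        hone, e3]
      simp only [smul_eq_mul]
      rw [← RCLike.ofReal_mul, ← RCLike.ofReal_mul, ← RCLike.ofReal_add, ← RCLike.ofReal_sub,
        RCLike.ofReal_nonneg]
      linarith [young_tangent (hf0 x) hl hr]
    have h2 := hA _ h1
    rw [map_sub, map_add, map_smul, map_smul] at h2
    filter_upwards [h2, hF0, hG0, h10,
        Lp.coeFn_sub (A G + (((r - 1) * l ^ r : ℝ) : 𝕜) • A one)
          (((r * l ^ (r - 1) : ℝ) : 𝕜) • A F),
        Lp.coeFn_add (A G) ((((r - 1) * l ^ r : ℝ) : 𝕜) • A one),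
        Lp.coeFn_smul (((r - 1) * l ^ r : ℝ) : 𝕜) (A one),
        Lp.coeFn_smul ((r * l ^ (r - 1) : ℝ) : 𝕜) (A F)] with x e1 e2 e3 e0 e4 e5 e6 e7
    rw [e4, Pi.sub_apply, e5, Pi.add_apply, e6, e7, Pi.smul_apply, Pi.smul_apply,
      eq_ofReal_norm_of_nonneg e2, eq_ofReal_norm_of_nonneg e3, eq_ofReal_norm_of_nonneg e0] at e1
    simp only [smul_eq_mul] at e1
    rw [← RCLike.ofReal_mul, ← RCLike.ofReal_mul, ← RCLike.ofReal_add, ← RCLike.ofReal_sub,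
        RCLike.ofReal_nonneg] at e1
    linarith
  filter_upwards [ae_all_iff.2 key, hA1] with x hx hx1
  have hall : ∀ c : ℝ, r * |c| ^ (r - 1) * ‖A F x‖ ≤
      ‖A G x‖ + (r - 1) * |c| ^ r * ‖A one x‖ := by
    intro c
    refine Rat.denseRange_cast.induction_on (p := fun c : ℝ => r * |c| ^ (r - 1) * ‖A F x‖ ≤
      ‖A G x‖ + (r - 1) * |c| ^ r * ‖A one x‖) c ?_ hx
    refine isClosed_le ?_ ?_
    · exact (continuous_const.mul (continuous_abs.rpow_const fun _ => Or.inr (by linarith))).mul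
        continuous_const
    · exact continuous_const.add ((continuous_const.mul
        (continuous_abs.rpow_const fun _ => Or.inr (by linarith))).mul continuous_const)
  set a := ‖A F x‖
  have ha : 0 ≤ a := norm_nonneg _
  -- `a / M` is the optimal tangent point once `A1` is bounded by `M`.
  have h3 := hall (a / M)
  rw [abs_of_nonneg (by positivity), Real.div_rpow ha hM.le, Real.div_rpow ha hM.le] at h3
  have h4 : (r - 1) * (a ^ r / M ^ r) * ‖A one x‖ ≤ (r - 1) * (a ^ r / M ^ r) * M := by
    gcongr
  rcases ha.eq_or_lt with h0 | h0
  · rw [← h0, Real.zero_rpow (by linarith)]; positivity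
  have e1 : a ^ r = a ^ (r - 1) * a := by
    rw [← Real.rpow_add_one h0.ne']; ring_nf
  have e2 : M ^ r = M ^ (r - 1) * M := by
    rw [← Real.rpow_add_one hM.ne']; ring_nf
  have hMr : 0 < M ^ (r - 1) := by positivity
  have h5 : r * (a ^ (r - 1) / M ^ (r - 1)) * a = r * (a ^ r / M ^ (r - 1)) := by
    rw [e1]; ring
  have h6 : (r - 1) * (a ^ r / M ^ r) * M = (r - 1) * (a ^ r / M ^ (r - 1)) := by
    rw [e2]; field_simp
  have h7 : a ^ r / M ^ (r - 1) ≤ ‖A G x‖ := by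
    rw [h5] at h3; rw [h6] at h4; linarith
  rw [div_le_iff₀ hMr] at h7
  linarith

/-- With `v = (Af)^(r/p)`, formally `∫ (Af)^(r + r/p) = ∫ (Af)^r v ≤ M^(r-1) ⟨f^r, A* v⟩ ≤ M^(r-1)
M' ∫ f^r`. -/
theorem IsPos.memLp_improve [IsFiniteMeasure μ] {A : Lp 𝕜 2 μ →L[𝕜] Lp 𝕜 2 μ} (hA : IsPos A)
    {M : ℝ} (hM : 0 < M)
    (hA1 : ∀ᵐ x ∂μ, ‖A (realLp (fun _ => 1) (memLp_const 1)) x‖ ≤ M) {p : ℝ≥0∞} (hp : 2 ≤ p)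
    (hp' : p ≠ ∞)
    (hB : ∀ v : Lp 𝕜 2 μ, MemLp v p μ →
      ∃ M' : ℝ, 0 < M' ∧ ∀ᵐ x ∂μ, ‖ContinuousLinearMap.adjoint A v x‖ ≤ M')
    {r : ℝ} (hr : 1 < r) {f : Lp 𝕜 2 μ} (hf0 : IsNonneg f) (hf : MemLp f (ENNReal.ofReal r) μ)
    (hAf : MemLp (A f) (ENNReal.ofReal r) μ) :
    MemLp (A f) (ENNReal.ofReal (r + r / p.toReal)) μ := by
  have hr0 : 0 < r := by linarith
  have hP : 0 < p.toReal := ENNReal.toReal_pos (by rintro rfl; simp at hp) hp'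
  have hvp : MemLp (fun x => ‖A f x‖ ^ (r / p.toReal)) p μ := by
    have h := hAf.norm_rpow_div (ENNReal.ofReal (r / p.toReal))
    rw [ENNReal.toReal_ofReal (by positivity), ← ENNReal.ofReal_div_of_pos (by positivity),
      div_div_cancel₀ hr0.ne', ENNReal.ofReal_toReal hp'] at h
    exact h
  have hv2 := hvp.mono_exponent hp
  set v : Lp 𝕜 2 μ := realLp _ hv2 with hv
  have hv' : v =ᵐ[μ] _ := coeFn_realLp _ hv2
  have hv0 : IsNonneg v := isNonneg_realLp (ae_of_all _ fun x => by positivity)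
  obtain ⟨M', hM', hBv⟩ := hB v ((memLp_congr_ae hv').2 hvp.ofReal)
  have hms : ∀ n : ℕ, MeasurableSet {x | ‖f x‖ ≤ n} := fun n =>
    measurableSet_le (Lp.stronglyMeasurable f).norm.measurable measurable_const
  -- `f^r` is only known to be in `L_1`, where `A` is not defined. The estimate is done for
  -- truncations, uniformly in `n`, and Fatou passes to the limit.
  set F : ℕ → α → ℝ := fun n => {x | ‖f x‖ ≤ n}.indicator (fun x => ‖f x‖) with hFdef
  have hFm : ∀ n, StronglyMeasurable (F n) := fun n =>
    (Lp.stronglyMeasurable f).norm.indicator (hms n)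
  have hF0 : ∀ n x, 0 ≤ F n x := fun n x => indicator_nonneg (fun _ _ => norm_nonneg _) _
  have hFle : ∀ n x, F n x ≤ ‖f x‖ := fun n x =>
    indicator_le_self' (fun _ _ => norm_nonneg _) x
  have hFn : ∀ n x, F n x ≤ n := fun n x =>
    indicator_le' (fun x hx => hx) (fun _ _ => Nat.cast_nonneg _) x
  have hF2 : ∀ n, MemLp (F n) 2 μ := fun n =>
    MemLp.of_bound (hFm n).aestronglyMeasurable n (ae_of_all _ fun x => by
      rw [Real.norm_of_nonneg (hF0 n x)]; exact hFn n x)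
  have hFr2 : ∀ n, MemLp (fun x => F n x ^ r) 2 μ := fun n =>
    MemLp.of_bound ((hFm n).measurable.pow_const r).aestronglyMeasurable ((n : ℝ) ^ r)
      (ae_of_all _ fun x => by
        rw [Real.norm_of_nonneg (Real.rpow_nonneg (hF0 n x) r)]
        exact Real.rpow_le_rpow (hF0 n x) (hFn n x) hr0.le)
  have hcut : ∀ n, realLp (F n) (hF2 n) = cutLp _ (hms n) f := by
    intro n
    apply Lp.ext
    filter_upwards [coeFn_realLp (𝕜 := 𝕜) _ (hF2 n), coeFn_cutLp _ (hms n) f, hf0] with x h1 h2 h3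
    rw [h1, h2, hFdef]
    by_cases hx : x ∈ {x | ‖f x‖ ≤ n}
    · simp only [indicator_of_mem hx]; exact (eq_ofReal_norm_of_nonneg h3).symm
    · simp only [indicator_of_notMem hx]; simp
  have htend : Tendsto (fun n => A (realLp (F n) (hF2 n))) atTop (𝓝 (A f)) := by
    simp_rw [hcut]
    refine (A.continuous.tendsto f).comp (tendsto_cutLp f _ hms (ae_of_all _ fun x => ?_))
    filter_upwards [(tendsto_natCast_atTop_atTop (R := ℝ)).eventually_ge_atTop ‖f x‖] with n hn
    exact Or.inr hn
  have hfint : Integrable (fun x => ‖f x‖ ^ r) μ := by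
    have := hf.integrable_norm_rpow (by simpa using hr0) ENNReal.ofReal_ne_top
    rwa [ENNReal.toReal_ofReal hr0.le] at this
  set C : ℝ := M ^ (r - 1) * (M' * ∫ x, ‖f x‖ ^ r ∂μ) with hC
  have hbound : ∀ n, ∫⁻ x, ENNReal.ofReal (‖A (realLp (F n) (hF2 n)) x‖ ^ r * ‖v x‖) ∂μ ≤
      ENNReal.ofReal C := by
    intro n
    set G : Lp 𝕜 2 μ := realLp _ (hFr2 n) with hG
    have hG0 : IsNonneg G := isNonneg_realLp (ae_of_all _ fun x => Real.rpow_nonneg (hF0 n x) r)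
    have h1 : ∫⁻ x, ENNReal.ofReal (‖A (realLp (F n) (hF2 n)) x‖ ^ r * ‖v x‖) ∂μ ≤
        ∫⁻ x, ENNReal.ofReal (M ^ (r - 1) * (‖A G x‖ * ‖v x‖)) ∂μ := by
      refine lintegral_mono_ae ?_
      filter_upwards [hA.rpow_apply_le hM hA1 hr (hF0 n) (hF2 n) (hFr2 n)] with x hx
      refine ENNReal.ofReal_le_ofReal ?_
      rw [← mul_assoc]
      gcongr
    refine h1.trans ?_
    rw [← ofReal_integral_eq_lintegral_ofReal ((integrable_norm_mul_norm _ _).const_mul _)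
      (ae_of_all _ fun x => by positivity), integral_const_mul]
    refine ENNReal.ofReal_le_ofReal (mul_le_mul_of_nonneg_left ?_ (by positivity))
    have h2 : ⟪A G, v⟫ = ⟪G, ContinuousLinearMap.adjoint A v⟫ :=
      (ContinuousLinearMap.adjoint_inner_right A G v).symm
    rw [inner_of_isNonneg (hA _ hG0) hv0, inner_of_isNonneg hG0 (hA.adjoint _ hv0),
      RCLike.ofReal_inj] at h2
    rw [h2, ← integral_const_mul]
    refine integral_mono_ae (integrable_norm_mul_norm _ _) (hfint.const_mul _) ?_
    filter_upwards [hBv, coeFn_realLp (𝕜 := 𝕜) _ (hFr2 n)] with x h3 h4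
    rw [hG, h4, RCLike.norm_ofReal, abs_of_nonneg (Real.rpow_nonneg (hF0 n x) r), mul_comm]
    gcongr
    · exact Real.rpow_nonneg (hF0 n x) r
    · exact hF0 n x
    · exact hFle n x
  obtain ⟨φ, -, hφ⟩ := exists_subseq_tendsto_ae htend
  have hfatou : ∫⁻ x, ENNReal.ofReal (‖A f x‖ ^ r * ‖v x‖) ∂μ ≤ ENNReal.ofReal C := by
    calc ∫⁻ x, ENNReal.ofReal (‖A f x‖ ^ r * ‖v x‖) ∂μ
        = ∫⁻ x, liminf (fun n => ENNReal.ofReal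
            (‖A (realLp (F (φ n)) (hF2 (φ n))) x‖ ^ r * ‖v x‖)) atTop ∂μ := by
          refine lintegral_congr_ae ?_
          filter_upwards [hφ] with x hx
          refine (Tendsto.liminf_eq ?_).symm
          refine ENNReal.tendsto_ofReal (Tendsto.mul_const _ ?_)
          exact (hx.norm).rpow_const (Or.inr hr0.le)
      _ ≤ liminf (fun n => ∫⁻ x, ENNReal.ofReal
            (‖A (realLp (F (φ n)) (hF2 (φ n))) x‖ ^ r * ‖v x‖) ∂μ) atTop := by
          refine lintegral_liminf_le' fun n => ?_
          exact (((Lp.aestronglyMeasurable _).norm.aemeasurable.pow_const r).mul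
            (Lp.aestronglyMeasurable _).norm.aemeasurable).ennreal_ofReal
      _ ≤ ENNReal.ofReal C :=
          liminf_le_of_frequently_le' (Frequently.of_forall fun n => hbound (φ n))
  have hpos : 0 < r + r / p.toReal := by positivity
  refine ⟨Lp.aestronglyMeasurable _, ?_⟩
  rw [eLpNorm_lt_top_iff_lintegral_rpow_enorm_lt_top (by simpa using hpos) ENNReal.ofReal_ne_top,
    ENNReal.toReal_ofReal hpos.le]
  refine lt_of_eq_of_lt (lintegral_congr_ae ?_) (hfatou.trans_lt ENNReal.ofReal_lt_top)
  filter_upwards [hv'] with x hx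
  rw [hx, RCLike.norm_ofReal, abs_of_nonneg (by positivity), ← Real.rpow_add' (norm_nonneg _)
    hpos.ne', ← ofReal_norm, ENNReal.ofReal_rpow_of_nonneg (norm_nonneg _) hpos.le]

end Improvement
theorem IsSemigroup.adjoint {𝕜 E : Type*} [RCLike 𝕜] [NormedAddCommGroup E] [InnerProductSpace 𝕜 E]
    [CompleteSpace E] {S : ℝ → E →L[𝕜] E} (hS : IsSemigroup S) :
    IsSemigroup (fun t => ContinuousLinearMap.adjoint (S t)) := fun s t hs ht => by
  simp only
  rw [add_comm t s, hS t s ht hs, ContinuousLinearMap.adjoint_comp]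

/-! ### Bootstrapping into `C(Ω̄)`, evaluation kernels, joint continuity -/

section Smoothing

variable {𝕜 : Type*} [RCLike 𝕜] {d : ℕ} {Ω : Set (EuclideanSpace ℝ (Fin d))} {p : ℝ≥0∞}

local notation "⟪" x ", " y "⟫" => inner 𝕜 x y

/-- A positive semigroup on `L_2(Ω)` which, together with its adjoint, maps `L_p(Ω)` into
`C(Ω̄)`. -/
structure IsSmoothing (p : ℝ≥0∞) (S : ℝ → LpOn 𝕜 2 Ω →L[𝕜] LpOn 𝕜 2 Ω) : Prop where
  semigroup : IsSemigroup S
  pos : ∀ t : ℝ, 0 < t → IsPos (S t)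
  mapsLpIntoC : ∀ t : ℝ, 0 < t → MapsLpIntoC p (S t)
  mapsLpIntoC_adjoint : ∀ t : ℝ, 0 < t → MapsLpIntoC p (ContinuousLinearMap.adjoint (S t))

variable {S : ℝ → LpOn 𝕜 2 Ω →L[𝕜] LpOn 𝕜 2 Ω}

theorem IsSmoothing.adjoint (hΩb : Bornology.IsBounded Ω) (hS : IsSmoothing p S) :
    IsSmoothing p (fun t => ContinuousLinearMap.adjoint (S t)) := by
  have := isFiniteMeasure_restrict_of_isBounded hΩb
  refine ⟨hS.semigroup.adjoint, fun t ht => (hS.pos t ht).adjoint, hS.mapsLpIntoC_adjoint,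
    fun t ht => ?_⟩
  simp only [ContinuousLinearMap.adjoint_adjoint]
  exact hS.mapsLpIntoC t ht

theorem IsSmoothing.apply_half (hS : IsSmoothing p S) {t : ℝ} (ht : 0 < t) (u : LpOn 𝕜 2 Ω) :
    S t u = S (t / 2) (S (t / 2) u) := by
  conv_lhs => rw [← add_halves t, hS.semigroup _ _ (half_pos ht) (half_pos ht)]
  rfl

theorem IsSmoothing.memLp_pow (hΩ : IsOpen Ω) (hΩb : Bornology.IsBounded Ω) (hp : 2 ≤ p)
    (hp' : p ≠ ∞) (hS : IsSmoothing p S) (n : ℕ) : ∀ t : ℝ, 0 < t → ∀ u : LpOn 𝕜 2 Ω,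
    MemLp (S t u) (ENNReal.ofReal (2 * (1 + 1 / p.toReal) ^ n)) (volume.restrict Ω) := by
  have := isFiniteMeasure_restrict_of_isBounded hΩb
  induction n with
  | zero => intro t ht u; simpa using Lp.memLp (S t u)
  | succ n ih =>
    intro t ht u
    have ht2 := half_pos ht
    have h1 : MemLp (realLp (𝕜 := 𝕜) (q := 2) (fun _ => 1) (memLp_const 1)) p
        (volume.restrict Ω) :=
      (memLp_congr_ae (coeFn_realLp _ _)).2 (memLp_const _)
    obtain ⟨g, hg⟩ := hS.mapsLpIntoC (t / 2) ht2 _ h1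
    obtain ⟨M, hM, hA1⟩ := hg.exists_bound hΩb hΩ
    have hB : ∀ v : LpOn 𝕜 2 Ω, MemLp v p (volume.restrict Ω) → ∃ M' : ℝ, 0 < M' ∧
        ∀ᵐ x ∂volume.restrict Ω, ‖ContinuousLinearMap.adjoint (S (t / 2)) v x‖ ≤ M' := by
      intro v hv
      obtain ⟨g, hg⟩ := hS.mapsLpIntoC_adjoint (t / 2) ht2 v hv
      exact hg.exists_bound hΩb hΩ
    have hr : (1 : ℝ) < 2 * (1 + 1 / p.toReal) ^ n := by
      have : (1 : ℝ) ≤ (1 + 1 / p.toReal) ^ n :=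
        one_le_pow₀ (le_add_of_nonneg_right (by positivity))
      linarith
    -- Taken with `A = S_{t/2}` and `f = S_{t/2}|u|`: both `f` and `Af` lie in the previous space by
    -- induction.
    have h2 := (hS.pos _ ht2).memLp_improve hM hA1 hp hp' hB hr
      (hS.pos _ ht2 _ (isNonneg_absLp u)) (ih _ ht2 _) (ih _ ht2 _)
    rw [← hS.apply_half ht] at h2
    have h3 : (2 * (1 + 1 / p.toReal) ^ n + 2 * (1 + 1 / p.toReal) ^ n / p.toReal) =
        2 * (1 + 1 / p.toReal) ^ (n + 1) := by ring
    rw [h3] at h2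
    exact h2.of_le_mul (Lp.aestronglyMeasurable _) ((hS.pos t ht).norm_apply_le u)

theorem IsSmoothing.exists_contVersion (hΩ : IsOpen Ω) (hΩb : Bornology.IsBounded Ω) (hp : 2 ≤ p)
    (hp' : p ≠ ∞) (hS : IsSmoothing p S) {t : ℝ} (ht : 0 < t) (u : LpOn 𝕜 2 Ω) :
    ∃ g, IsContVersion Ω (S t u) g := by
  have := isFiniteMeasure_restrict_of_isBounded hΩb
  have hP : 0 < p.toReal := ENNReal.toReal_pos (by rintro rfl; simp at hp) hp'
  obtain ⟨n, hn⟩ := pow_unbounded_of_one_lt p.toReal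
    (show 1 < 1 + 1 / p.toReal by have : 0 < 1 / p.toReal := by positivity
                                  linarith)
  rw [hS.apply_half ht]
  refine hS.mapsLpIntoC _ (half_pos ht) _
    ((hS.memLp_pow hΩ hΩb hp hp' n _ (half_pos ht) u).mono_exponent ?_)
  rw [← ENNReal.ofReal_toReal hp']
  refine ENNReal.ofReal_le_ofReal ?_
  rw [ENNReal.toReal_ofReal hP.le]
  linarith

/-- By the closed graph theorem `A` is bounded into `C(Ω̄)`; Riesz represents its composition with
each evaluation, with norm at most that of `A` into `C(Ω̄)`. -/
theorem exists_evaluation_kernel (hΩ : IsOpen Ω) (hΩb : Bornology.IsBounded Ω)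
    (A : LpOn 𝕜 2 Ω →L[𝕜] LpOn 𝕜 2 Ω) (hA : ∀ u, ∃ g, IsContVersion Ω (A u) g) :
    ∃ k : EuclideanSpace ℝ (Fin d) → LpOn 𝕜 2 Ω,
      (∀ u, IsContVersion Ω (A u) (fun x => ⟪k x, u⟫)) ∧
      ∃ C : ℝ, ∀ x ∈ closure Ω, ‖k x‖ ≤ C := by
  classical
  choose g hg using hA
  have := isCompact_iff_compactSpace.1 hΩb.isCompact_closure
  let G : LpOn 𝕜 2 Ω →ₗ[𝕜] C(closure Ω, 𝕜) :=
    { toFun := fun u => ⟨(closure Ω).domRestrict (g u), (hg u).1.domRestrict⟩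
      map_add' := fun u v => by
        ext x
        refine (hg (u + v)).eqOn hΩ (v := (A u : _ → 𝕜) + (A v : _ → 𝕜)) (h := g u + g v)
          ⟨(hg u).1.add (hg v).1, (hg u).2.add (hg v).2⟩ ?_ x.2
        rw [map_add]; exact Lp.coeFn_add _ _
      map_smul' := fun c u => by
        ext x
        refine (hg (c • u)).eqOn hΩ (v := c • (A u : _ → 𝕜)) (h := c • g u)
          ⟨(hg u).1.const_smul c, (hg u).2.const_smul c⟩ ?_ x.2
        rw [map_smul]; exact Lp.coeFn_smul _ _ }
  have hG : Continuous G := by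
    refine G.continuous_of_seq_closed_graph fun u x y hu hy => ?_
    obtain ⟨φ, hφm, hφ⟩ := exists_subseq_tendsto_ae ((A.continuous.tendsto x).comp hu)
    have hpt : ∀ z : closure Ω, Tendsto (fun n => g (u n) z) atTop (𝓝 (y z)) := fun z =>
      ((ContinuousMap.evalCLM 𝕜 z).continuous.tendsto y).comp hy
    have hyv : IsContVersion Ω (A x) (fun z => if h : z ∈ closure Ω then y ⟨z, h⟩ else 0) := by
      refine ⟨?_, ?_⟩
      · rw [continuousOn_iff_continuous_domRestrict]
        convert y.continuous using 1
        ext z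
        simp
      · filter_upwards [hφ, ae_restrict_mem hΩ.measurableSet, ae_all_iff.2 fun n => (hg (u n)).2]
          with z h1 h2 h3
        have h4 : z ∈ closure Ω := subset_closure h2
        rw [dif_pos h4]
        refine tendsto_nhds_unique ((hpt ⟨z, h4⟩).comp hφm.tendsto_atTop) ?_
        simpa [Function.comp_def, h3] using h1
    ext z
    have := hyv.eqOn hΩ (hg x) EventuallyEq.rfl z.2
    simp only [dif_pos z.2] at this
    exact this
  let G' : LpOn 𝕜 2 Ω →L[𝕜] C(closure Ω, 𝕜) := ⟨G, hG⟩
  let k : EuclideanSpace ℝ (Fin d) → LpOn 𝕜 2 Ω := fun x => if h : x ∈ closure Ω then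
    (InnerProductSpace.toDual 𝕜 _).symm ((ContinuousMap.evalCLM 𝕜 ⟨x, h⟩).comp G') else 0
  have hk : ∀ x ∈ closure Ω, ∀ u, ⟪k x, u⟫ = g u x := by
    intro x hx u
    simp only [k, dif_pos hx, InnerProductSpace.toDual_symm_apply]
    rfl
  refine ⟨k, fun u => ⟨(hg u).1.congr fun x hx => hk x hx u, ?_⟩, ‖G'‖, fun x hx => ?_⟩
  · filter_upwards [(hg u).2, ae_restrict_mem hΩ.measurableSet] with x h1 h2
    rw [hk x (subset_closure h2), h1]
  · simp only [k, dif_pos hx, LinearIsometryEquiv.norm_map]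
    refine ContinuousLinearMap.opNorm_le_bound _ (norm_nonneg _) fun u => ?_
    exact (ContinuousMap.norm_coe_le_norm (G' u) ⟨x, hx⟩).trans (G'.le_opNorm u)

/-- `k t x` represents the evaluation at `x` after the operator `S t`. -/
structure IsKernel (S : ℝ → LpOn 𝕜 2 Ω →L[𝕜] LpOn 𝕜 2 Ω)
    (k : ℝ → EuclideanSpace ℝ (Fin d) → LpOn 𝕜 2 Ω) : Prop where
  isContVersion : ∀ t : ℝ, 0 < t → ∀ u, IsContVersion Ω (S t u) (fun x => ⟪k t x, u⟫)
  bound : ∀ t : ℝ, 0 < t → ∃ C : ℝ, ∀ x ∈ closure Ω, ‖k t x‖ ≤ C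

theorem IsSmoothing.exists_isKernel (hΩ : IsOpen Ω) (hΩb : Bornology.IsBounded Ω) (hp : 2 ≤ p)
    (hp' : p ≠ ∞) (hS : IsSmoothing p S) : ∃ k, IsKernel S k := by
  have h : ∀ t : ℝ, ∃ k : EuclideanSpace ℝ (Fin d) → LpOn 𝕜 2 Ω, 0 < t →
      (∀ u, IsContVersion Ω (S t u) (fun x => ⟪k x, u⟫)) ∧
      ∃ C : ℝ, ∀ x ∈ closure Ω, ‖k x‖ ≤ C := by
    intro t
    by_cases ht : 0 < t
    · obtain ⟨k, hk⟩ := exists_evaluation_kernel hΩ hΩb (S t)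
        fun u => hS.exists_contVersion hΩ hΩb hp hp' ht u
      exact ⟨k, fun _ => hk⟩
    · exact ⟨0, fun h => absurd h ht⟩
  choose k hk using h
  exact ⟨k, fun t ht => (hk t ht).1, fun t ht => (hk t ht).2⟩

variable {k k' : ℝ → EuclideanSpace ℝ (Fin d) → LpOn 𝕜 2 Ω}

theorem IsKernel.inner_add (hΩ : IsOpen Ω) (hS : IsSemigroup S) (hk : IsKernel S k) {t s : ℝ}
    (ht : 0 < t) (hs : 0 < s) {x : EuclideanSpace ℝ (Fin d)} (hx : x ∈ closure Ω)
    (u : LpOn 𝕜 2 Ω) : ⟪k (t + s) x, u⟫ = ⟪k t x, S s u⟫ := by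
  refine (hk.isContVersion _ (add_pos ht hs) u).eqOn hΩ (hk.isContVersion t ht (S s u)) ?_ hx
  rw [hS s t hs ht]
  exact EventuallyEq.rfl

theorem IsKernel.adjoint_apply (hΩ : IsOpen Ω) (hS : IsSemigroup S) (hk : IsKernel S k) {t s : ℝ}
    (ht : 0 < t) (hs : 0 < s) {x : EuclideanSpace ℝ (Fin d)} (hx : x ∈ closure Ω) :
    ContinuousLinearMap.adjoint (S s) (k t x) = k (t + s) x :=
  ext_inner_right 𝕜 fun u => by
    rw [ContinuousLinearMap.adjoint_inner_left, hk.inner_add hΩ hS ht hs hx]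

theorem IsKernel.isNonneg (hΩ : IsOpen Ω) (hΩb : Bornology.IsBounded Ω) (hk : IsKernel S k)
    (hS : ∀ t : ℝ, 0 < t → IsPos (S t)) {t : ℝ} (ht : 0 < t) {x : EuclideanSpace ℝ (Fin d)}
    (hx : x ∈ closure Ω) : IsNonneg (k t x) := by
  have := isFiniteMeasure_restrict_of_isBounded hΩb
  refine isNonneg_of_inner_nonneg fun v hv => ?_
  have h := (hk.isContVersion t ht v).nonneg hΩ (hS t ht v hv) x hx
  rw [← inner_conj_symm]
  rwa [eq_ofReal_norm_of_nonneg h, RCLike.conj_ofReal, RCLike.ofReal_nonneg, ← RCLike.ofReal_nonneg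
    (K := 𝕜), ← eq_ofReal_norm_of_nonneg h]

/-- The kernel of `S_{2s}` in terms of the kernels of `S_s` and its adjoint. -/
theorem IsKernel.coeFn_ae (hΩ : IsOpen Ω) (hS : IsSemigroup S) (hk : IsKernel S k)
    (hk' : IsKernel (fun t => ContinuousLinearMap.adjoint (S t)) k') {t s : ℝ}
    (ht : 0 < t) (hs : 0 < s) {x : EuclideanSpace ℝ (Fin d)} (hx : x ∈ closure Ω) :
    k (t + s) x =ᵐ[volume.restrict Ω] fun z => ⟪k' s z, k t x⟫ := by
  rw [← hk.adjoint_apply hΩ hS ht hs hx]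
  exact (hk'.isContVersion s hs (k t x)).2.symm

/-- What is known of `x ↦ k_s(x)` is weak continuity, which does not suffice for joint continuity of
a pairing. One more factorization writes the pairing at time `2s` as `∫ ⟨k_s(w), k'_s(y)⟩ ⟨k_s(x),
k'_s(w)⟩ dw`, where the variables separate and dominated convergence applies. -/
theorem IsKernel.continuousOn_inner (hΩ : IsOpen Ω) (hΩb : Bornology.IsBounded Ω)
    (hS : IsSemigroup S) (hS' : IsSemigroup (fun t => ContinuousLinearMap.adjoint (S t)))
    (hk : IsKernel S k)
    (hk' : IsKernel (fun t => ContinuousLinearMap.adjoint (S t)) k') {s : ℝ} (hs : 0 < s) :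
    ContinuousOn (fun z : EuclideanSpace ℝ (Fin d) × EuclideanSpace ℝ (Fin d) =>
      ⟪k (s + s) z.1, k' (s + s) z.2⟫) (closure Ω ×ˢ closure Ω) := by
  have := isFiniteMeasure_restrict_of_isBounded hΩb
  have hk'' : IsKernel (fun t => ContinuousLinearMap.adjoint (ContinuousLinearMap.adjoint (S t)))
      k := by simpa using hk
  obtain ⟨C, hC⟩ := hk.bound s hs
  obtain ⟨C', hC'⟩ := hk'.bound s hs
  have hCC : ∀ x ∈ closure Ω, ∀ y ∈ closure Ω, ‖⟪k s x, k' s y⟫‖ ≤ C * C' := fun x hx y hy =>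
    (norm_inner_le_norm _ _).trans (mul_le_mul (hC x hx) (hC' y hy) (norm_nonneg _)
      ((norm_nonneg _).trans (hC x hx)))
  have hcont : ContinuousOn (fun z : EuclideanSpace ℝ (Fin d) × EuclideanSpace ℝ (Fin d) =>
      ∫ w in Ω, ⟪k s w, k' s z.2⟫ * ⟪k s z.1, k' s w⟫) (closure Ω ×ˢ closure Ω) := by
    refine continuousOn_of_dominated (bound := fun _ => (C * C') * (C * C')) ?_ ?_ ?_ ?_
    · rintro ⟨x, y⟩ ⟨hx, hy⟩
      have h1 : ContinuousOn (fun w => ⟪k s w, k' s y⟫) (closure Ω) :=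
        (hk.isContVersion s hs _).1
      have h2 : ContinuousOn (fun w => ⟪k s x, k' s w⟫) (closure Ω) := by
        have := RCLike.continuous_conj.comp_continuousOn (hk'.isContVersion s hs (k s x)).1
        simpa [Function.comp_def] using this
      exact ((h1.mul h2).mono subset_closure).aestronglyMeasurable hΩ.measurableSet
    · rintro ⟨x, y⟩ ⟨hx, hy⟩
      filter_upwards [ae_restrict_mem hΩ.measurableSet] with w hw
      rw [norm_mul]
      exact mul_le_mul (hCC _ (subset_closure hw) _ hy) (hCC _ hx _ (subset_closure hw))
        (norm_nonneg _) ((norm_nonneg _).trans (hCC _ hx _ hy))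
    · exact integrable_const _
    · filter_upwards [ae_restrict_mem hΩ.measurableSet] with w hw
      have h1 : ContinuousOn (fun x => ⟪k s x, k' s w⟫) (closure Ω) :=
        (hk.isContVersion s hs _).1
      have h2 : ContinuousOn (fun y => ⟪k s w, k' s y⟫) (closure Ω) := by
        have := RCLike.continuous_conj.comp_continuousOn (hk'.isContVersion s hs (k s w)).1
        simpa [Function.comp_def] using this
      exact (h2.comp continuousOn_snd fun z hz => hz.2).mul
        (h1.comp continuousOn_fst fun z hz => hz.1)
  refine hcont.congr ?_
  rintro ⟨x, y⟩ ⟨hx, hy⟩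
  simp only
  rw [L2.inner_def]
  refine integral_congr_ae ?_
  filter_upwards [hk.coeFn_ae hΩ hS hk' hs hs hx, hk'.coeFn_ae hΩ hS' hk'' hs hs hy] with w h1 h2
  rw [h1, h2, RCLike.inner_apply, inner_conj_symm]

end Smoothing
-- The inclusion of `L_q` into `L_2`
section Inclusion

variable {α : Type*} [MeasurableSpace α] {μ : Measure α} [IsFiniteMeasure μ] {𝕜 : Type*} [RCLike 𝕜]
  {q : ℝ≥0∞} [Fact (1 ≤ q)]

/-- The inclusion of `L_q` into `L_2` for a finite measure and `q ≥ 2`. -/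
noncomputable def inclL2 (hq : 2 ≤ q) : Lp 𝕜 q μ →L[𝕜] Lp 𝕜 2 μ :=
  LinearMap.mkContinuous
    { toFun := fun u => ((Lp.memLp u).mono_exponent hq).toLp u
      map_add' := fun u v => by
        rw [← MemLp.toLp_add]
        exact MemLp.toLp_congr _ _ (Lp.coeFn_add u v)
      map_smul' := fun c u => by
        rw [RingHom.id_apply, ← MemLp.toLp_const_smul]
        exact MemLp.toLp_congr _ _ (Lp.coeFn_smul c u) }
    ((μ univ ^ (1 / (2 : ℝ≥0∞).toReal - 1 / q.toReal)).toReal) fun u => by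
      simp only [LinearMap.coe_mk, AddHom.coe_mk]
      rw [Lp.norm_toLp, Lp.norm_def, mul_comm, ← ENNReal.toReal_mul]
      refine ENNReal.toReal_mono (ENNReal.mul_ne_top (Lp.eLpNorm_ne_top u) ?_)
        (eLpNorm_le_eLpNorm_mul_rpow_measure_univ hq (Lp.aestronglyMeasurable u))
      refine ENNReal.rpow_ne_top_of_nonneg ?_ (measure_ne_top μ univ)
      rcases eq_or_ne q ∞ with rfl | hq'
      · simp
      · rw [sub_nonneg]
        exact one_div_le_one_div_of_le (by simp) (ENNReal.toReal_mono hq' hq)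

theorem coeFn_inclL2 (hq : 2 ≤ q) (u : Lp 𝕜 q μ) : inclL2 hq u =ᵐ[μ] u :=
  MemLp.coeFn_toLp ((Lp.memLp u).mono_exponent hq)

theorem IsNonneg.inclL2 (hq : 2 ≤ q) {u : Lp 𝕜 q μ} (hu : IsNonneg u) :
    IsNonneg (inclL2 hq u) := by
  filter_upwards [hu, coeFn_inclL2 hq u] with x h1 h2
  rwa [h2]

theorem exists_inclL2_eq (hq : 2 ≤ q) {v : Lp 𝕜 2 μ} (hv : MemLp v q μ) :
    ∃ f : Lp 𝕜 q μ, inclL2 hq f = v :=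
  ⟨hv.toLp v, Lp.ext ((coeFn_inclL2 hq _).trans hv.coeFn_toLp)⟩

end Inclusion

/-! ### Vanishing pairings and complexification -/

section Pairing

variable {α : Type*} [MeasurableSpace α] {μ : Measure α} {𝕜 : Type*} [RCLike 𝕜]

local notation "⟪" x ", " y "⟫" => inner 𝕜 x y

theorem ae_mul_eq_zero_of_inner_eq_zero {k w : Lp 𝕜 2 μ} (hk : IsNonneg k) (hw : IsNonneg w)
    (h : ⟪k, w⟫ = 0) : ∀ᵐ x ∂μ, k x * w x = 0 := by
  rw [inner_of_isNonneg hk hw, RCLike.ofReal_eq_zero, integral_eq_zero_iff_of_nonneg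
    (fun x => by positivity) (integrable_norm_mul_norm k w)] at h
  filter_upwards [h] with x hx
  rw [← norm_eq_zero, norm_mul]
  exact hx

theorem inner_eq_zero_of_ae_mul_eq_zero {k w : Lp 𝕜 2 μ} (h : ∀ᵐ x ∂μ, k x * w x = 0) :
    ⟪k, w⟫ = 0 := by
  rw [L2.inner_def, ← integral_zero α 𝕜 (μ := μ)]
  refine integral_congr_ae ?_
  filter_upwards [h] with x hx
  rcases mul_eq_zero.1 hx with hx | hx <;> rw [hx] <;> simp

theorem ae_mul_eq_zero_of_norm_le {k u v : Lp 𝕜 2 μ} (hk : IsNonneg k) (hv : IsNonneg v)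
    (h : ∀ᵐ x ∂μ, ‖u x‖ ≤ 2 * ‖v x‖) (hkv : ⟪k, v⟫ = 0) : ∀ᵐ x ∂μ, k x * u x = 0 := by
  filter_upwards [ae_mul_eq_zero_of_inner_eq_zero hk hv hkv, h] with x h1 h2
  rcases mul_eq_zero.1 h1 with h1 | h1
  · rw [h1, zero_mul]
  · rw [h1, norm_zero, mul_zero] at h2
    rw [norm_le_zero_iff.1 h2, mul_zero]

theorem map_conj_mul (a b : 𝕜) : RCLike.map 𝕜 ℂ (b * (starRingEnd 𝕜) a) =
    RCLike.map 𝕜 ℂ b * (starRingEnd ℂ) (RCLike.map 𝕜 ℂ a) := by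
  -- The real case (`I = 0`, all imaginary parts vanish) and the complex case.
  rcases RCLike.I_eq_zero_or_im_I_eq_one (K := 𝕜) with h | h
  · have him : ∀ z : 𝕜, RCLike.im z = 0 := fun z => by
      have := RCLike.mul_im_I_ax z
      rw [← this, h]; simp
    apply Complex.ext <;> simp [him]
  · apply Complex.ext <;> simp

theorem inner_compLp_map (u v : Lp 𝕜 2 μ) :
    inner ℂ ((RCLike.map 𝕜 ℂ).compLp u) ((RCLike.map 𝕜 ℂ).compLp v) =
      RCLike.map 𝕜 ℂ ⟪u, v⟫ := by
  rw [L2.inner_def, L2.inner_def, ← ContinuousLinearMap.integral_comp_comm _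
    (L2.integrable_inner u v)]
  refine integral_congr_ae ?_
  filter_upwards [(RCLike.map 𝕜 ℂ).coeFn_compLp u, (RCLike.map 𝕜 ℂ).coeFn_compLp v] with x h1 h2
  rw [h1, h2, RCLike.inner_apply, RCLike.inner_apply, map_conj_mul]

theorem map_eq_zero_iff_eq_zero (a : 𝕜) : RCLike.map 𝕜 ℂ a = 0 ↔ a = 0 := by
  refine ⟨fun h => ?_, fun h => by rw [h, map_zero]⟩
  have h1 := congrArg Complex.re h
  have h2 := congrArg Complex.im h
  simp at h1 h2
  apply RCLike.ext <;> simp [h1, h2]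

end Pairing

theorem sector_mem_nhds {θ t : ℝ} (hθ : 0 < θ) (ht : 0 < t) : sector θ ∈ 𝓝 (t : ℂ) := by
  have h1 : ContinuousAt Complex.arg (t : ℂ) :=
    Complex.continuousAt_arg (Complex.ofReal_mem_slitPlane.2 ht)
  have h2 : ∀ᶠ z in 𝓝 (t : ℂ), |z.arg| < θ := by
    refine h1.abs.eventually_lt continuousAt_const ?_
    rwa [Complex.arg_ofReal_of_nonneg ht.le, abs_zero]
  filter_upwards [h2, isOpen_ne.mem_nhds (show (t : ℂ) ≠ 0 by exact_mod_cast ht.ne')] with z h3 h4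
  exact ⟨h4, h3⟩

/-! ### The closed ideal annihilated by a family of functions -/

section Annihilator

variable {𝕜 : Type*} [RCLike 𝕜] {d : ℕ} {Ω : Set (EuclideanSpace ℝ (Fin d))} {p : ℝ≥0∞}

/-- The elements of `L_p(Ω)` vanishing a.e. where some `v r`, `r > 0`, does not vanish. -/
def annihilator (p : ℝ≥0∞) (v : ℝ → LpOn 𝕜 2 Ω) : Submodule 𝕜 (LpOn 𝕜 p Ω) where
  carrier := {u | ∀ r : ℝ, 0 < r → ∀ᵐ y ∂volume.restrict Ω, v r y * u y = 0}
  add_mem' := fun {u w} hu hw r hr => by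
    filter_upwards [hu r hr, hw r hr, Lp.coeFn_add u w] with y h1 h2 h3
    rw [h3, Pi.add_apply, mul_add, h1, h2, add_zero]
  zero_mem' := fun r hr => by
    filter_upwards [Lp.coeFn_zero 𝕜 p (volume.restrict Ω)] with y h1
    rw [h1, Pi.zero_apply, mul_zero]
  smul_mem' := fun c u hu r hr => by
    filter_upwards [hu r hr, Lp.coeFn_smul c u] with y h1 h2
    rw [h2, Pi.smul_apply, smul_eq_mul, mul_left_comm, h1, mul_zero]

theorem isLatticeIdeal_annihilator (v : ℝ → LpOn 𝕜 2 Ω) : IsLatticeIdeal (annihilator p v) where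
  abs_mem u hu w hw r hr := by
    filter_upwards [hu r hr, hw] with y h1 h2
    rcases mul_eq_zero.1 h1 with h1 | h1 <;> simp [h1, h2]
  mem_of_le u hu w hw r hr := by
    filter_upwards [hu r hr, hw] with y h1 h2
    rcases mul_eq_zero.1 h1 with h1 | h1
    · simp [h1]
    · rw [h1] at h2
      rw [le_antisymm h2.2 h2.1, mul_zero]

theorem isClosed_annihilator [Fact (1 ≤ p)] (v : ℝ → LpOn 𝕜 2 Ω) :
    IsClosed (annihilator p v : Set (LpOn 𝕜 p Ω)) := by
  refine IsSeqClosed.isClosed fun u w hu hw r hr => ?_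
  obtain ⟨φ, -, hφ⟩ := exists_subseq_tendsto_ae hw
  filter_upwards [hφ, ae_all_iff.2 fun n => hu n r hr] with y h1 h2
  refine tendsto_nhds_unique (h1.const_mul (v r y)) ?_
  simp [h2]

end Annihilator

/-! ### Analyticity, irreducibility and non-vanishing -/

section Semigroup

variable {𝕜 : Type*} [RCLike 𝕜] {d : ℕ} {Ω : Set (EuclideanSpace ℝ (Fin d))} {p : ℝ≥0∞}
  [Fact (1 ≤ p)] [IsFiniteMeasure ((volume : Measure (EuclideanSpace ℝ (Fin d))).restrict Ω)]
  {T : ℝ → LpOn 𝕜 p Ω →L[𝕜] LpOn 𝕜 p Ω} {S : ℝ → LpOn 𝕜 2 Ω →L[𝕜] LpOn 𝕜 2 Ω}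
  {k k' : ℝ → EuclideanSpace ℝ (Fin d) → LpOn 𝕜 2 Ω}

local notation "⟪" x ", " y "⟫" => inner 𝕜 x y

/-- Uniqueness of analytic continuation for the orbits of a holomorphic semigroup. -/
theorem IsHolomorphic.inner_eq_zero (hp : 2 ≤ p) (hT : IsHolomorphic T) (v : LpOn 𝕜 2 Ω)
    (f : LpOn 𝕜 p Ω) {t₀ : ℝ} (ht₀ : 0 < t₀)
    (h : ∃ᶠ t in 𝓝[≠] t₀, ⟪v, inclL2 hp (T t f)⟫ = 0) {t : ℝ} (ht : 0 < t) :
    ⟪v, inclL2 hp (T t f)⟫ = 0 := by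
  obtain ⟨θ, hθ, -, Z, hZ, hZT⟩ := hT
  set vC : LpOn ℂ 2 Ω := (RCLike.map 𝕜 ℂ).compLp v
  set fC : LpOn ℂ p Ω := (RCLike.map 𝕜 ℂ).compLp f
  set F : ℂ → ℂ := fun z => (innerSL ℂ vC).comp (inclL2 hp) (Z z fC) with hF
  have hFd : DifferentiableOn ℂ F (sector θ) := fun z hz =>
    ((innerSL ℂ vC).comp (inclL2 hp)).differentiableAt.comp_differentiableWithinAt z
      ((hZ.differentiableOn z hz).clm_apply (differentiableWithinAt_const fC))
  have hFt : ∀ s : ℝ, 0 < s → F s = RCLike.map 𝕜 ℂ ⟪v, inclL2 hp (T s f)⟫ := by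
    intro s hs
    rw [← inner_compLp_map, hF]
    simp only [ContinuousLinearMap.comp_apply, innerSL_apply_apply]
    rw [hZT s hs f]
    congr 1
    apply Lp.ext
    filter_upwards [coeFn_inclL2 hp ((RCLike.map 𝕜 ℂ).compLp (T s f)), coeFn_inclL2 hp (T s f),
      (RCLike.map 𝕜 ℂ).coeFn_compLp (T s f),
      (RCLike.map 𝕜 ℂ).coeFn_compLp (inclL2 hp (T s f))] with x h1 h2 h3 h4
    rw [h1, h3, h4, h2]
  -- The identity theorem is applied to the real-analytic restriction to the connected set `(0, ∞)`.
  have hFa : AnalyticOnNhd ℝ (fun s : ℝ => F s) (Ioi 0) := fun s hs =>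
    ((hFd.analyticAt (sector_mem_nhds hθ hs)).restrictScalars (𝕜 := ℝ)).fun_comp
      (Complex.ofRealCLM.analyticAt s)
  have h0 : ∃ᶠ s : ℝ in 𝓝[≠] t₀, F s = 0 := by
    have hev : ∀ᶠ s : ℝ in 𝓝[≠] t₀, 0 < s :=
      eventually_nhdsWithin_of_eventually_nhds (lt_mem_nhds ht₀)
    refine (h.and_eventually hev).mono fun s hs => ?_
    rw [hFt s hs.2, hs.1, map_zero]
  have h1 := hFa.eqOn_zero_of_preconnected_of_frequently_eq_zero isPreconnected_Ioi ht₀ h0 ht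
  simp only [Pi.zero_apply] at h1
  rwa [hFt t ht, map_eq_zero_iff_eq_zero] at h1

theorem IsRestriction.inclL2_apply (hp : 2 ≤ p) (hTS : IsRestriction T S) {t : ℝ} (ht : 0 < t)
    (u : LpOn 𝕜 p Ω) : inclL2 hp (T t u) = S t (inclL2 hp u) :=
  Lp.ext ((coeFn_inclL2 hp _).trans (hTS t ht u _ (coeFn_inclL2 hp u).symm))

/-- Bounded truncations lie in `L_p`, where `T` is positive, and converge in `L_2`. -/
theorem IsRestriction.isPos (hTS : IsRestriction T S) (hT : IsPositive T) {t : ℝ}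
    (ht : 0 < t) : IsPos (S t) := by
  intro u hu
  have hms : ∀ n : ℕ, MeasurableSet {x | ‖u x‖ ≤ n} := fun n =>
    measurableSet_le (Lp.stronglyMeasurable u).norm.measurable measurable_const
  have htend : Tendsto (fun n => S t (cutLp _ (hms n) u)) atTop (𝓝 (S t u)) := by
    refine ((S t).continuous.tendsto u).comp (tendsto_cutLp u _ hms (ae_of_all _ fun x => ?_))
    filter_upwards [(tendsto_natCast_atTop_atTop (R := ℝ)).eventually_ge_atTop ‖u x‖] with n hn
    exact Or.inr hn
  refine IsNonneg.of_tendsto htend fun n => ?_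
  have hcut := coeFn_cutLp _ (hms n) u
  have hm : MemLp (cutLp _ (hms n) u) p (volume.restrict Ω) := by
    refine MemLp.of_bound (Lp.aestronglyMeasurable _) n ?_
    filter_upwards [hcut] with x hx
    rw [hx]
    by_cases h : x ∈ {x | ‖u x‖ ≤ n}
    · rw [indicator_of_mem h]; exact h
    · rw [indicator_of_notMem h]; simp
  have h0 : IsNonneg (hm.toLp _) := by
    filter_upwards [hm.coeFn_toLp, hu.cutLp _ (hms n)] with x h1 h2
    rwa [h1]
  have h1 := hT t ht _ h0
  filter_upwards [h1, hTS t ht _ _ hm.coeFn_toLp] with x h2 h3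
  rwa [← h3]

/-- If a positive orbit vanishes at `x` at some time, then it vanishes there at all times. -/
theorem IsKernel.inner_eq_zero_of_inner_eq_zero (hΩ : IsOpen Ω) (hΩb : Bornology.IsBounded Ω)
    (hp : 2 ≤ p) (hS : IsSmoothing p S) (hTS : IsRestriction T S) (hT : IsC0Semigroup T)
    (hTpos : IsPositive T) (hThol : IsHolomorphic T) (hk : IsKernel S k)
    {x : EuclideanSpace ℝ (Fin d)} (hx : x ∈ closure Ω) {f : LpOn 𝕜 p Ω} (hf : IsNonneg f)
    {t₀ : ℝ} (ht₀ : 0 < t₀) (h₀ : ⟪k t₀ x, inclL2 hp f⟫ = 0) {r : ℝ} (hr : 0 < r) :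
    ⟪k r x, inclL2 hp f⟫ = 0 := by
  -- Point evaluation is available only after smoothing: a short time `s` is spent in the fixed
  -- functional `k_s(x)`, and analyticity is used in the remaining time.
  obtain ⟨s, hs, hst, hsr⟩ : ∃ s, 0 < s ∧ s < t₀ ∧ s < r := by
    obtain ⟨s, h1, h2⟩ := exists_between (lt_min ht₀ hr)
    exact ⟨s, h1, lt_min_iff.1 h2⟩
  have hseq : Tendsto (fun n : ℕ => 1 / ((n : ℝ) + 1)) atTop (𝓝[>] 0) :=
    tendsto_nhdsWithin_iff.2 ⟨tendsto_one_div_add_atTop_nhds_zero_nat,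
      Eventually.of_forall fun n => by simp only [mem_Ioi]; positivity⟩
  obtain ⟨φ, hφm, hφ⟩ := exists_subseq_tendsto_ae ((hT.tendsto_zero f).comp hseq)
  set a : ℕ → ℝ := fun n => 1 / ((φ n : ℝ) + 1) with ha
  have ha0 : ∀ n, 0 < a n := fun n => by positivity
  have halim : Tendsto a atTop (𝓝 0) :=
    tendsto_one_div_add_atTop_nhds_zero_nat.comp hφm.tendsto_atTop
  -- On `A m`, `f ≤ 2 T_{a_n} f` for all `n ≥ m`. Since `T_{a_n} f → f` a.e., these sets exhaust the
  -- support of `f`.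
  set A : ℕ → Set (EuclideanSpace ℝ (Fin d)) := fun m =>
    {y | ∀ n, m ≤ n → ‖f y‖ ≤ 2 * ‖T (a n) f y‖} with hA
  have hAm : ∀ m, MeasurableSet (A m) := fun m => by
    rw [hA]
    simp only [ofPred_forall]
    exact MeasurableSet.iInter fun n => MeasurableSet.iInter fun _ =>
      measurableSet_le (Lp.stronglyMeasurable f).norm.measurable
        ((Lp.stronglyMeasurable _).norm.measurable.const_mul 2)
  have hincl : ∀ m, inclL2 hp (cutLp (A m) (hAm m) f) = cutLp (A m) (hAm m) (inclL2 hp f) := by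
    intro m
    apply Lp.ext
    filter_upwards [coeFn_inclL2 hp (cutLp (A m) (hAm m) f), coeFn_cutLp (A m) (hAm m) f,
      coeFn_cutLp (A m) (hAm m) (inclL2 hp f), coeFn_inclL2 hp f] with y h1 h2 h3 h4
    rw [h1, h2, h3]
    by_cases hy : y ∈ A m
    · rw [indicator_of_mem hy, indicator_of_mem hy, h4]
    · rw [indicator_of_notMem hy, indicator_of_notMem hy]
  have hcut : Tendsto (fun m => inclL2 hp (cutLp (A m) (hAm m) f)) atTop (𝓝 (inclL2 hp f)) := by
    simp_rw [hincl]
    refine tendsto_cutLp _ A hAm ?_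
    filter_upwards [hφ, coeFn_inclL2 hp f] with y h1 h2
    rw [h2]
    rcases eq_or_ne (f y) 0 with h3 | h3
    · exact Eventually.of_forall fun _ => Or.inl h3
    · have h4 : ‖f y‖ / 2 < ‖f y‖ := half_lt_self (norm_pos_iff.2 h3)
      obtain ⟨m, hm⟩ := eventually_atTop.1 (h1.norm.eventually (lt_mem_nhds h4))
      filter_upwards [eventually_ge_atTop m] with n hn
      refine Or.inr fun j hj => ?_
      have h5 := hm j (hn.trans hj)
      simp only [Function.comp_apply] at h5
      change ‖f y‖ / 2 < ‖T (a j) f y‖ at h5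
      linarith
  have hzero : ∀ m, ∀ t : ℝ, 0 < t → ⟪k s x, inclL2 hp (T t (cutLp (A m) (hAm m) f))⟫ = 0 := by
    intro m t ht
    refine hThol.inner_eq_zero hp (k s x) _ (t₀ := t₀ - s) (sub_pos.2 hst) ?_ ht
    have h1 : Tendsto (fun n => t₀ - s - a n) atTop (𝓝[≠] (t₀ - s)) := by
      refine tendsto_nhdsWithin_iff.2 ⟨by simpa using tendsto_const_nhds.sub halim,
        Eventually.of_forall fun n => ?_⟩
      have := ha0 n
      simp only [mem_compl_iff, mem_singleton_iff]
      linarith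
    refine h1.frequently (Eventually.frequently ?_)
    filter_upwards [eventually_ge_atTop m, halim.eventually (gt_mem_nhds (sub_pos.2 hst))]
      with n hn hn'
    have hτ : 0 < t₀ - s - a n := by linarith
    rw [hTS.inclL2_apply hp hτ, ← hk.inner_add hΩ hS.semigroup hs hτ hx]
    have hsτ := add_pos hs hτ
    have hkn := hk.isNonneg hΩ hΩb hS.pos hsτ hx
    refine inner_eq_zero_of_ae_mul_eq_zero (ae_mul_eq_zero_of_norm_le hkn
      (v := inclL2 hp (T (a n) f)) (IsNonneg.inclL2 hp (hTpos _ (ha0 n) f hf)) ?_ ?_)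
    · filter_upwards [coeFn_inclL2 hp (cutLp (A m) (hAm m) f), coeFn_cutLp (A m) (hAm m) f,
        coeFn_inclL2 hp (T (a n) f)] with y h1 h2 h3
      rw [h1, h2, h3]
      by_cases hy : y ∈ A m
      · rw [indicator_of_mem hy]; exact hy n hn
      · rw [indicator_of_notMem hy, norm_zero]; positivity
    · rw [hTS.inclL2_apply hp (ha0 n), ← hk.inner_add hΩ hS.semigroup hsτ (ha0 n) hx]
      rw [← h₀]; congr 2; ring
  have hrs : 0 < r - s := sub_pos.2 hsr
  have hlim : Tendsto (fun m => ⟪k s x, S (r - s) (inclL2 hp (cutLp (A m) (hAm m) f))⟫) atTop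
      (𝓝 ⟪k s x, S (r - s) (inclL2 hp f)⟫) :=
    tendsto_const_nhds.inner (((S (r - s)).continuous.tendsto _).comp hcut)
  have h1 : (fun m => ⟪k s x, S (r - s) (inclL2 hp (cutLp (A m) (hAm m) f))⟫) = fun _ => 0 := by
    funext m
    rw [← hTS.inclL2_apply hp hrs, hzero m _ hrs]
  rw [h1] at hlim
  rw [← add_sub_cancel s r, hk.inner_add hΩ hS.semigroup hs hrs hx]
  exact tendsto_nhds_unique hlim tendsto_const_nhds

theorem IsKernel.inner_ne_zero (hΩ : IsOpen Ω) (hΩb : Bornology.IsBounded Ω)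
    (hp : 2 ≤ p) (hS : IsSmoothing p S) (hTS : IsRestriction T S) (hT : IsC0Semigroup T)
    (hTpos : IsPositive T) (hTirr : IsIrreducible T) (hThol : IsHolomorphic T) (hk : IsKernel S k)
    {x : EuclideanSpace ℝ (Fin d)} (hx : x ∈ closure Ω) (hxS : NonvanishingAt p S x)
    {f : LpOn 𝕜 p Ω} (hf : IsNonneg f) (hf0 : f ≠ 0) {t : ℝ} (ht : 0 < t) :
    ⟪k t x, inclL2 hp f⟫ ≠ 0 := by
  intro h₀
  have h1 : ∀ r : ℝ, 0 < r → ⟪k r x, inclL2 hp f⟫ = 0 := fun r hr =>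
    hk.inner_eq_zero_of_inner_eq_zero hΩ hΩb hp hS hTS hT hTpos hThol hx hf ht h₀ hr
  have hkn : ∀ r : ℝ, 0 < r → IsNonneg (k r x) := fun r hr => hk.isNonneg hΩ hΩb hS.pos hr hx
  have hfmem : f ∈ annihilator p (fun r => k r x) := fun r hr => by
    filter_upwards [ae_mul_eq_zero_of_inner_eq_zero (hkn r hr) (IsNonneg.inclL2 hp hf) (h1 r hr),
      coeFn_inclL2 hp f] with y h2 h3
    rwa [h3] at h2
  -- Invariance holds because `⟨k_r(x), S_s|u|⟩ = ⟨k_{r+s}(x), |u|⟩ = 0`, and `S_s|u|` dominates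
  -- `S_s u` up to the factor 2.
  have hinv : ∀ s : ℝ, 0 < s → ∀ u ∈ annihilator p (fun r => k r x),
      T s u ∈ annihilator p (fun r => k r x) := by
    intro s hs u hu r hr
    have h2 : ⟪k r x, S s (absLp (inclL2 hp u))⟫ = 0 := by
      rw [← hk.inner_add hΩ hS.semigroup hr hs hx]
      refine inner_eq_zero_of_ae_mul_eq_zero ?_
      filter_upwards [hu _ (add_pos hr hs), coeFn_absLp (inclL2 hp u), coeFn_inclL2 hp u]
        with y h2 h3 h4
      rw [h3, h4]
      rcases mul_eq_zero.1 h2 with h2 | h2 <;> simp [h2]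
    have h3 := ae_mul_eq_zero_of_norm_le (hkn r hr) (hS.pos s hs _ (isNonneg_absLp _))
      ((hS.pos s hs).norm_apply_le (inclL2 hp u)) h2
    rw [← hTS.inclL2_apply hp hs] at h3
    filter_upwards [h3, coeFn_inclL2 hp (T s u)] with y h4 h5
    rwa [h5] at h4
  rcases hTirr _ (isLatticeIdeal_annihilator _) (isClosed_annihilator _) hinv with hJ | hJ
  · obtain ⟨r, hr, w, hw, g, hg, hgx⟩ := hxS
    apply hgx
    rw [hg.eqOn hΩ (hk.isContVersion r hr w) EventuallyEq.rfl hx]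
    have hmem : hw.toLp w ∈ annihilator p (fun r => k r x) := by rw [hJ]; trivial
    refine inner_eq_zero_of_ae_mul_eq_zero ?_
    filter_upwards [hmem r hr, hw.coeFn_toLp] with y h2 h3
    rwa [h3] at h2
  · rw [hJ, Submodule.mem_bot] at hfmem
    exact hf0 hfmem

/-- The kernels of the adjoint semigroup do not vanish. -/
theorem IsKernel.ne_zero_of_adjoint (hΩ : IsOpen Ω) (hΩb : Bornology.IsBounded Ω) (hp : 2 ≤ p)
    (hS : IsSmoothing p S) (hTS : IsRestriction T S) (hThol : IsHolomorphic T)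
    (hk' : IsKernel (fun t => ContinuousLinearMap.adjoint (S t)) k')
    (hmem : ∀ t : ℝ, 0 < t → ∀ y ∈ closure Ω, MemLp (k' t y) p (volume.restrict Ω))
    {y : EuclideanSpace ℝ (Fin d)} (hy : y ∈ closure Ω)
    (hyS : NonvanishingAt p (fun t => ContinuousLinearMap.adjoint (S t)) y)
    {t : ℝ} (ht : 0 < t) : k' t y ≠ 0 := by
  intro h₀
  have hS' := hS.adjoint hΩb
  have hadd : ∀ r s : ℝ, 0 < r → 0 < s → S s (k' r y) = k' (r + s) y := fun r s hr hs => by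
    have h := hk'.adjoint_apply hΩ hS'.semigroup hr hs hy
    rwa [ContinuousLinearMap.adjoint_adjoint] at h
  obtain ⟨r, hr, w, hw, g, hg, hgx⟩ := hyS
  apply hgx
  rw [hg.eqOn hΩ (hk'.isContVersion r hr w) EventuallyEq.rfl hy]
  suffices h : k' r y = 0 by simp only [h, inner_zero_left]
  have hr2 := half_pos hr
  obtain ⟨f, hf⟩ := exists_inclL2_eq hp (hmem (r / 2) hr2 y hy)
  have h1 : ∀ s : ℝ, 0 < s → inclL2 hp (T s f) = k' (r / 2 + s) y := fun s hs => by
    rw [hTS.inclL2_apply hp hs, hf, hadd _ _ hr2 hs]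
  have h2 : ∀ v : LpOn 𝕜 2 Ω, ⟪v, k' r y⟫ = 0 := fun v => by
    rw [← add_halves r, ← h1 _ hr2]
    -- Any base time beyond `t` would do: the orbit vanishes in a whole neighbourhood of it.
    refine hThol.inner_eq_zero hp v f (t₀ := t + 1) (by positivity) ?_ hr2
    refine Eventually.frequently (eventually_nhdsWithin_of_eventually_nhds ?_)
    filter_upwards [lt_mem_nhds (show t < t + 1 by linarith)] with s hs
    have hs0 : 0 < s := ht.trans hs
    have h3 : k' (r / 2 + s) y = S (r / 2 + s - t) (k' t y) := by
      rw [hadd t _ ht (by linarith)]; congr 1; ring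
    rw [h1 s hs0, h3, h₀, map_zero, inner_zero_right]
  exact inner_self_eq_zero.1 (h2 (k' r y))

end Semigroup
end StrictPos

/-! ### The kernel and its strict positivity -/

theorem corollary3p3 {𝕜 : Type*} [RCLike 𝕜] {d : ℕ} (Ω : Set (EuclideanSpace ℝ (Fin d)))
    (hΩ : IsOpen Ω) (hΩb : Bornology.IsBounded Ω)
    (p : ℝ≥0∞) [Fact (1 ≤ p)] (hp : 2 ≤ p) (hp' : p ≠ ∞)
    (S : ℝ → StrictPos.LpOn 𝕜 2 Ω →L[𝕜] StrictPos.LpOn 𝕜 2 Ω)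
    (hS : StrictPos.IsSemigroup S)
    (hSC : ∀ t : ℝ, 0 < t → StrictPos.MapsLpIntoC p (S t) ∧
      StrictPos.MapsLpIntoC p (ContinuousLinearMap.adjoint (S t)))
    (hSx : ∀ x ∈ closure Ω, StrictPos.NonvanishingAt p S x)
    (hSx' : ∀ x ∈ closure Ω,
      StrictPos.NonvanishingAt p (fun t => ContinuousLinearMap.adjoint (S t)) x)
    (T : ℝ → StrictPos.LpOn 𝕜 p Ω →L[𝕜] StrictPos.LpOn 𝕜 p Ω)
    (hTS : StrictPos.IsRestriction T S)
    (hT : StrictPos.IsC0Semigroup T) (hTpos : StrictPos.IsPositive T)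
    (hTirr : StrictPos.IsIrreducible T) (hThol : StrictPos.IsHolomorphic T) :
    ∀ t : ℝ, 0 < t → ∃ K : EuclideanSpace ℝ (Fin d) → EuclideanSpace ℝ (Fin d) → 𝕜,
      ContinuousOn (Function.uncurry K) (closure Ω ×ˢ closure Ω) ∧
      (∀ u : StrictPos.LpOn 𝕜 2 Ω, ∃ g, StrictPos.IsContVersion Ω (S t u) g ∧
        ∀ x ∈ closure Ω, g x = ∫ y in Ω, K x y * u y) ∧
      ∀ x ∈ closure Ω, ∀ y ∈ closure Ω, 0 < K x y := by
  have hfin := StrictPos.isFiniteMeasure_restrict_of_isBounded hΩb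
  have hsm : StrictPos.IsSmoothing p S :=
    ⟨hS, fun t ht => hTS.isPos hTpos ht, fun t ht => (hSC t ht).1, fun t ht => (hSC t ht).2⟩
  have hsm' := hsm.adjoint hΩb
  obtain ⟨k, hk⟩ := hsm.exists_isKernel hΩ hΩb hp hp'
  obtain ⟨k', hk'⟩ := hsm'.exists_isKernel hΩ hΩb hp hp'
  -- `k'_t(y) = S_{t/2} k'_{t/2}(y)` has a continuous version on the compact closure, hence is
  -- bounded.
  have hmem : ∀ t : ℝ, 0 < t → ∀ y ∈ closure Ω, MemLp (k' t y) p (volume.restrict Ω) := by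
    intro t ht y hy
    have h1 := hk'.adjoint_apply hΩ hsm'.semigroup (half_pos ht) (half_pos ht) hy
    rw [ContinuousLinearMap.adjoint_adjoint, add_halves] at h1
    obtain ⟨C, -, hC⟩ := (hk.isContVersion _ (half_pos ht) (k' (t / 2) y)).exists_bound hΩb hΩ
    rw [h1] at hC
    exact MemLp.of_bound (Lp.aestronglyMeasurable _) C hC
  intro t ht
  have ht2 := half_pos ht
  have ht4 := half_pos ht2
  refine ⟨fun x y => inner 𝕜 (k (t / 2) x) (k' (t / 2) y), ?_, fun u =>
    ⟨_, hk.isContVersion t ht u, fun x hx => ?_⟩, fun x hx y hy => ?_⟩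
  · have := hk.continuousOn_inner hΩ hΩb hS hsm'.semigroup hk' ht4
    rwa [add_halves] at this
  · have h1 := hk.coeFn_ae hΩ hS hk' ht2 ht2 hx
    rw [add_halves] at h1
    rw [L2.inner_def]
    refine integral_congr_ae ?_
    filter_upwards [h1] with y h2
    rw [h2, RCLike.inner_apply, inner_conj_symm, mul_comm]
  · have h0 := StrictPos.inner_nonneg_of_isNonneg (hk.isNonneg hΩ hΩb hsm.pos ht2 hx)
      (hk'.isNonneg hΩ hΩb hsm'.pos ht2 hy)
    refine lt_of_le_of_ne h0 (Ne.symm ?_)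
    have hm := hmem (t / 2) ht2 y hy
    obtain ⟨f, hincl⟩ := StrictPos.exists_inclL2_eq hp hm
    have hnn : StrictPos.IsNonneg f := by
      have hf := StrictPos.coeFn_inclL2 hp f
      rw [hincl] at hf
      filter_upwards [hf, hk'.isNonneg hΩ hΩb hsm'.pos ht2 hy] with z h1 h2
      rwa [← h1]
    have hne : f ≠ 0 := fun h => by
      rw [h, map_zero] at hincl
      exact hk'.ne_zero_of_adjoint hΩ hΩb hp hsm hTS hThol hmem hy (hSx' y hy) ht2 hincl.symm
    have := hk.inner_ne_zero hΩ hΩb hp hsm hTS hT hTpos hTirr hThol hx (hSx x hx) hnn hne ht2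
    rwa [hincl] at this
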